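/- Let $X$ be a locally compact Hausdorff space, $\mathcal H$ a separable complex Hilbert space and $\mathcal K$ the algebra of compact operators on $\mathcal H$; identify $C_0(X)\otimes\mathcal K$ with $C_0(X,\mathcal K)$. A $C_0(X)$-endomorphism of $C_0(X)\otimes\mathcal K$ is a $*$-homomorphism from $C_0(X)\otimes\mathcal K$ to itself which commutes with multiplication by elements of $C_0(X)$ and maps approximate units to approximate units. Such an $\alpha$ has the form $\alpha(f)(x)=\alpha_x(f(x))$ for unique endomorphisms $\alpha_x$ of $\mathcal K$ ($x\in X$), and we let $$\mathrm{vect}(\alpha)=\{(x,T)\in X\times\mathcal B(\mathcal H)\;:\; TA=\alpha_x(A)T\ \text{ for all }A\in\mathcal K\},$$ with the topology induced from $X\times\mathcal B(\mathcal H)$, where $\mathcal B(\mathcal H)$ carries the strong operator topology. The fiber of $\mathrm{vect}(\alpha)$ over $x$ is a complex vector space with the inner product $\langle S,T\rangle=T^*S\in\mathbb C\cdot 1$. Theorem. Let $\alpha,\beta$ be $C_0(X)$-endomorphisms of $C_0(X)\otimes\mathcal K$. Then $\mathrm{vect}(\alpha)\cong\mathrm{vect}(\beta)$ over $X$ if and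 only if there is a unitary $U$ in the multiplier algebra $\mathcal M(C_0(X)\otimes\mathcal K)$ with $\alpha=\mathrm{Ad}\,U\circ\beta$, i.e. $\alpha(f)=U\beta(f)U^*$ for all $f\in C_0(X)\otimes\mathcal K$. This holds both when $\cong$ means isomorphism of complex vector bundles (a homeomorphism over $X$ that is linear on fibers) and when it means isomorphism of Hermitian vector bundles (in addition isometric on fibers). Moreover, if $\mathcal H$ is infinite-dimensional, then $\alpha$ and $\beta$ are homotopic (connected by a path of $C_0(X)$-endomorphisms which is continuous in the point-norm topology) if and only if $\alpha=\mathrm{Ad}\,U\circ\beta$ for some unitary $U\in\mathcal M(C_0(X)\otimes\mathcal K)$. -/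

import Mathlib

open Topology Filter
open scoped ZeroAtInfty InnerProductSpace

noncomputable section

namespace CXEnd

/-! ### The algebra of compact operators -/

theorem isCompactOperator_adjoint {H : Type*} [NormedAddCommGroup H] [InnerProductSpace ℂ H]
    [CompleteSpace H] {T : H →L[ℂ] H} (hT : IsCompactOperator T) :
    IsCompactOperator (star T : H →L[ℂ] H) := by
  have h2 : IsCompactOperator (T.comp (star T : H →L[ℂ] H)) := hT.comp_clm _
  refine (isCompactOperator_iff_isCompact_closure_image_ball
    ((star T : H →L[ℂ] H) : H →ₗ[ℂ] H) one_pos).mpr ?_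
  have h3 : TotallyBounded ((T.comp (star T : H →L[ℂ] H)) '' Metric.ball 0 1) :=
    (IsCompactOperator.isCompact_closure_image_ball
      (f := ((T.comp (star T : H →L[ℂ] H)) : H →ₗ[ℂ] H)) h2 1).totallyBounded.subset
      subset_closure
  refine TotallyBounded.isCompact_of_isClosed (TotallyBounded.closure ?_) isClosed_closure
  rw [Metric.totallyBounded_iff]
  intro ε hε
  obtain ⟨t, hts, htf, ht⟩ := Metric.finite_approx_of_totallyBounded h3 (ε ^ 2 / 2) (by positivity)
  have hts' : ∀ y, ∃ z : H, y ∈ t → z ∈ Metric.ball (0 : H) 1 ∧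
      (T.comp (star T : H →L[ℂ] H)) z = y := fun y => by
    by_cases hy : y ∈ t
    · obtain ⟨z, hz⟩ := hts hy
      exact ⟨z, fun _ => hz⟩
    · exact ⟨0, fun h => absurd h hy⟩
  choose g hg using hts'
  refine ⟨(fun y => (star T : H →L[ℂ] H) (g y)) '' t, htf.image _, ?_⟩
  rintro _ ⟨x, hx, rfl⟩
  obtain ⟨y, hy, hxy⟩ := Set.mem_iUnion₂.mp (ht ⟨x, hx, rfl⟩)
  refine Set.mem_iUnion₂.mpr ⟨_, ⟨y, hy, rfl⟩, ?_⟩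
  obtain ⟨hgb, hgy⟩ := hg y hy
  rw [Metric.mem_ball, dist_eq_norm] at hxy ⊢
  rw [← hgy, ← map_sub] at hxy
  have hb : ‖x - g y‖ < 2 := by
    have h1 := norm_sub_le x (g y)
    rw [mem_ball_zero_iff] at hx hgb
    linarith
  have key : ‖(star T : H →L[ℂ] H) (x - g y)‖ ^ 2
      ≤ ‖(T.comp (star T : H →L[ℂ] H)) (x - g y)‖ * ‖x - g y‖ := by
    have h1 := ContinuousLinearMap.apply_norm_sq_eq_inner_adjoint_left (star T : H →L[ℂ] H)
      (x - g y)
    rw [h1, ← ContinuousLinearMap.star_eq_adjoint, star_star]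
    exact (RCLike.re_le_norm _).trans (norm_inner_le_norm _ _)
  have h5 : ‖(star T : H →L[ℂ] H) (x - g y)‖ ^ 2 < ε ^ 2 := by
    have h6 : ‖(T.comp (star T : H →L[ℂ] H)) (x - g y)‖ < ε ^ 2 / 2 := hxy
    nlinarith [norm_nonneg ((T.comp (star T : H →L[ℂ] H)) (x - g y)), norm_nonneg (x - g y)]
  have h7 := lt_of_pow_lt_pow_left₀ 2 hε.le h5
  simpa using h7

/-- The compact operators on `H`, as a `*`-subalgebra of the bounded operators. -/
def compactOps (H : Type*) [NormedAddCommGroup H] [InnerProductSpace ℂ H] [CompleteSpace H] :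
    NonUnitalStarSubalgebra ℂ (H →L[ℂ] H) where
  carrier := {T | IsCompactOperator T}
  add_mem' := fun {_ _} ha hb => IsCompactOperator.add ha hb
  zero_mem' := isCompactOperator_zero
  mul_mem' := fun {_ b} ha _ => IsCompactOperator.comp_clm ha b
  smul_mem' := fun c _ ha => IsCompactOperator.smul ha c
  star_mem' := fun {_} ha => isCompactOperator_adjoint ha

instance isClosed_compactOps (H : Type*) [NormedAddCommGroup H] [InnerProductSpace ℂ H]
    [CompleteSpace H] : IsClosed (compactOps H : Set (H →L[ℂ] H)) :=
  isClosed_setOfPred_isCompactOperator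

/-- The C*-algebra `K` of compact operators on `H`. -/
def 𝒦 (H : Type*) [NormedAddCommGroup H] [InnerProductSpace ℂ H] [CompleteSpace H] : Type _ :=
  compactOps H

instance (H : Type*) [NormedAddCommGroup H] [InnerProductSpace ℂ H] [CompleteSpace H] :
    NonUnitalCStarAlgebra (𝒦 H) :=
  NonUnitalStarSubalgebra.nonUnitalCStarAlgebra (compactOps H)

instance (H : Type*) [NormedAddCommGroup H] [InnerProductSpace ℂ H] [CompleteSpace H] :
    CoeOut (𝒦 H) (H →L[ℂ] H) := ⟨fun A => A.1⟩

/-- The C*-algebra `C₀(X) ⊗ K`, as the algebra of norm-continuous functions `X → K` vanishing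
at infinity. -/
abbrev C0K (X H : Type*) [TopologicalSpace X] [NormedAddCommGroup H] [InnerProductSpace ℂ H]
    [CompleteSpace H] : Type _ :=
  C₀(X, 𝒦 H)

section Basic

variable {X : Type*} [TopologicalSpace X]
  {H : Type*} [NormedAddCommGroup H] [InnerProductSpace ℂ H] [CompleteSpace H]

/-- The multiplication action of `C₀(X)` on `C₀(X) ⊗ K`. -/
def C0smul (g : C₀(X, ℂ)) (f : C0K X H) : C0K X H where
  toFun x := g x • f x
  continuous_toFun := (map_continuous g).smul (map_continuous f)
  zero_at_infty' := by
    simpa using (zero_at_infty g).smul (zero_at_infty f)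

end Basic

/-! ### Endomorphisms -/

/-- A `C₀(X)`-endomorphism of `C₀(X) ⊗ K`: a `*`-homomorphism of `C₀(X) ⊗ K` to itself which
commutes with the multiplication action of `C₀(X)`, and is unital in the sense that it maps
approximate units to approximate units. -/
structure C0End (X H : Type*) [TopologicalSpace X] [NormedAddCommGroup H]
    [InnerProductSpace ℂ H] [CompleteSpace H] where
  toHom : C0K X H →⋆ₙₐ[ℂ] C0K X H
  map_C0smul : ∀ (g : C₀(X, ℂ)) (f : C0K X H), toHom (C0smul g f) = C0smul g (toHom f)
  map_approximateUnit : ∀ l : Filter (C0K X H), l.IsApproximateUnit →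
    (l.map toHom).IsApproximateUnit

section Endo

variable {X : Type*} [TopologicalSpace X]
  {H : Type*} [NormedAddCommGroup H] [InnerProductSpace ℂ H] [CompleteSpace H]

instance : CoeFun (C0End X H) (fun _ => C0K X H → C0K X H) := ⟨fun α => α.toHom⟩

/-- The point-norm topology on the set of `C₀(X)`-endomorphisms. -/
instance : TopologicalSpace (C0End X H) :=
  TopologicalSpace.induced (fun (α : C0End X H) (f : C0K X H) => α f) inferInstance

theorem exists_apply_eq [LocallyCompactSpace X] [T2Space X] (x : X) (a : 𝒦 H) :
    ∃ f : C0K X H, f x = a := by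
  obtain ⟨g, hg1, -, hgc, -⟩ := exists_continuous_one_zero_of_isCompact
    (isCompact_singleton (x := x)) isClosed_empty (Set.disjoint_empty _)
  refine ⟨⟨⟨fun y => ((g y : ℝ) : ℂ) • a, by fun_prop⟩, ?_⟩, ?_⟩
  · have h := hgc.is_zero_at_infty
    have h2 : Tendsto (fun y => ((g y : ℝ) : ℂ)) (cocompact X) (𝓝 0) := by
      simpa [Function.comp_def] using (Complex.continuous_ofReal.tendsto 0).comp h
    simpa using h2.smul_const a
  · change ((g x : ℝ) : ℂ) • a = a
    simp [hg1 rfl]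

theorem apply_eq_zero (α : C0End X H) {f : C0K X H} {x : X} (hf : f x = 0) : α f x = 0 := by
  rw [← norm_le_zero_iff]
  refine le_of_forall_pos_le_add fun ε hε => ?_
  have hpos : ∀ y, 0 < ‖f y‖ + ε := fun y => by positivity
  let g : C₀(X, ℂ) :=
    { toFun := fun y => ((‖f y‖ / (‖f y‖ + ε) : ℝ) : ℂ)
      continuous_toFun := by
        have h := map_continuous f
        refine Complex.continuous_ofReal.comp (h.norm.div (h.norm.add continuous_const) ?_)
        exact fun y => (hpos y).ne'
      zero_at_infty' := by
        have h := (zero_at_infty f).norm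
        have h2 := h.div (h.add_const ε) (by simpa using hε.ne')
        have h3 := (Complex.continuous_ofReal.tendsto _).comp h2
        simpa [Function.comp_def] using h3 }
  have hgx : g x = 0 := by
    change ((‖f x‖ / (‖f x‖ + ε) : ℝ) : ℂ) = 0
    simp [hf]
  have h1 : α f x = α (f - C0smul g f) x := by
    have : α.toHom (f - C0smul g f) = α.toHom f - C0smul g (α.toHom f) := by
      rw [map_sub, α.map_C0smul]
    rw [this]
    change _ = α.toHom f x - g x • α.toHom f x
    simp [hgx]
  have h2 : ‖f - C0smul g f‖ ≤ ε := by
    rw [← ZeroAtInftyContinuousMap.norm_toBCF_eq_norm, BoundedContinuousFunction.norm_le hε.le]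
    intro y
    change ‖f y - ((‖f y‖ / (‖f y‖ + ε) : ℝ) : ℂ) • f y‖ ≤ ε
    have h3 : f y - ((‖f y‖ / (‖f y‖ + ε) : ℝ) : ℂ) • f y
        = ((ε / (‖f y‖ + ε) : ℝ) : ℂ) • f y := by
      have : ((ε / (‖f y‖ + ε) : ℝ) : ℂ) = 1 - ((‖f y‖ / (‖f y‖ + ε) : ℝ) : ℂ) := by
        rw [← Complex.ofReal_one, ← Complex.ofReal_sub]
        congr 1
        have := (hpos y).ne'
        field_simp
        ring
      rw [this, sub_smul, one_smul]
    rw [h3, norm_smul, Complex.norm_real, Real.norm_of_nonneg (by positivity), div_mul_eq_mul_div,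
      div_le_iff₀ (hpos y)]
    nlinarith [norm_nonneg (f y)]
  rw [h1, zero_add]
  calc ‖α.toHom (f - C0smul g f) x‖ ≤ ‖α.toHom (f - C0smul g f)‖ := by
        rw [← ZeroAtInftyContinuousMap.norm_toBCF_eq_norm]
        exact (α.toHom (f - C0smul g f)).toBCF.norm_coe_le_norm x
    _ ≤ ‖f - C0smul g f‖ := NonUnitalStarAlgHom.norm_apply_le _ _
    _ ≤ ε := h2

theorem apply_eq_of_eq (α : C0End X H) {f g : C0K X H} {x : X} (h : f x = g x) :
    α f x = α g x := by
  have h1 : α.toHom (f - g) x = 0 := apply_eq_zero α (by simp [h])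
  rw [map_sub] at h1
  exact sub_eq_zero.mp h1

variable [LocallyCompactSpace X] [T2Space X]

/-- Some element of `C₀(X) ⊗ K` with the value `a` at `x`. -/
def lift (x : X) (a : 𝒦 H) : C0K X H := (exists_apply_eq x a).choose

theorem lift_apply (x : X) (a : 𝒦 H) : lift x a x = a := (exists_apply_eq x a).choose_spec

/-- The endomorphism `α_x` of `K` induced by `α` on the fiber over `x`; it is characterized by
`α(f)(x) = α_x(f(x))`, see `apply_eq_fiber`. -/
def fiber (α : C0End X H) (x : X) : 𝒦 H →⋆ₙₐ[ℂ] 𝒦 H where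
  toFun a := α (lift x a) x
  map_smul' c a := by
    have h : α.toHom (lift x (c • a)) x = α.toHom (c • lift x a) x :=
      apply_eq_of_eq α (by simp [lift_apply])
    simpa using h
  map_zero' := apply_eq_zero α (lift_apply x 0)
  map_add' a b := by
    have h : α.toHom (lift x (a + b)) x = α.toHom (lift x a + lift x b) x :=
      apply_eq_of_eq α (by simp [lift_apply])
    simpa using h
  map_mul' a b := by
    have h : α.toHom (lift x (a * b)) x = α.toHom (lift x a * lift x b) x :=
      apply_eq_of_eq α (by simp [lift_apply])
    simpa using h
  map_star' a := by
    have h : α.toHom (lift x (star a)) x = α.toHom (star (lift x a)) x :=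
      apply_eq_of_eq α (by simp [lift_apply])
    simpa [map_star] using h

theorem apply_eq_fiber (α : C0End X H) (f : C0K X H) (x : X) : α f x = fiber α x (f x) :=
  apply_eq_of_eq α (lift_apply x (f x)).symm

end Endo

/-! ### The bundle of intertwiners -/

section Vect

variable {X : Type*} [TopologicalSpace X]
  {H : Type*} [NormedAddCommGroup H] [InnerProductSpace ℂ H] [CompleteSpace H]

/-- For an endomorphism `φ` of `K`, the space `V_φ = {T ∈ B(H) | T A = φ(A) T for all A ∈ K}`.
Here `H →Lₚₜ[ℂ] H` is `B(H)` with the topology of pointwise convergence, i.e. the strong operator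
topology. -/
def intertwiners (φ : 𝒦 H →⋆ₙₐ[ℂ] 𝒦 H) : Submodule ℂ (H →Lₚₜ[ℂ] H) where
  carrier := {T | ∀ (A : 𝒦 H) (ξ : H),
    T ((A : H →L[ℂ] H) ξ) = ((φ A : 𝒦 H) : H →L[ℂ] H) (T ξ)}
  add_mem' {S T} hS hT A ξ := by simp [hS A ξ, hT A ξ]
  zero_mem' A ξ := by simp
  smul_mem' c T hT A ξ := by simp [hT A ξ]

variable [LocallyCompactSpace X] [T2Space X]

/-- The total space of the bundle `vect(α)`, topologized as a subspace of `X × B(H)`, with the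
strong operator topology on `B(H)`; the projection to `X` is the first coordinate, and the fiber
over `x` is the vector space `V_{α_x}`. -/
def vect (α : C0End X H) : Set (X × (H →Lₚₜ[ℂ] H)) :=
  {p | p.2 ∈ intertwiners (fiber α p.1)}

/-- An isomorphism of complex vector bundles `vect(α) ≅ vect(β)` over `X`: a family of linear
isomorphisms between the fibers over each point of `X`, which together form a homeomorphism of
the total spaces. -/
structure VectIso (α β : C0End X H) where
  fiberIso : ∀ x : X, intertwiners (fiber α x) ≃ₗ[ℂ] intertwiners (fiber β x)
  continuous_toFun : Continuous fun p : vect α =>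
    (⟨(p.1.1, (fiberIso p.1.1 ⟨p.1.2, p.2⟩).1), (fiberIso p.1.1 ⟨p.1.2, p.2⟩).2⟩ : vect β)
  continuous_invFun : Continuous fun p : vect β =>
    (⟨(p.1.1, ((fiberIso p.1.1).symm ⟨p.1.2, p.2⟩).1),
      ((fiberIso p.1.1).symm ⟨p.1.2, p.2⟩).2⟩ : vect α)

/-- The isomorphism `e` is one of Hermitian vector bundles. The inner product `⟨S, T⟩` of two
intertwiners `S, T` in a fiber is the scalar operator `T* S`, so that `e` is isometric when
`e(T)* e(S) = T* S`, which is spelled out here on vectors. -/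
def VectIso.IsHermitian {α β : C0End X H} (e : VectIso α β) : Prop :=
  ∀ (x : X) (S T : intertwiners (fiber α x)) (ξ η : H),
    ⟪(e.fiberIso x T).1 η, (e.fiberIso x S).1 ξ⟫_ℂ = ⟪T.1 η, S.1 ξ⟫_ℂ

/-- `α = Ad U ∘ β` for some unitary `U` of the multiplier algebra of `C₀(X) ⊗ K`, that is
`α(f) = U β(f) U*` for all `f`. -/
def InnerEquivalent (α β : C0End X H) : Prop :=
  ∃ U ∈ unitary (DoubleCentralizer ℂ (C0K X H)), ∀ f : C0K X H,
    (DoubleCentralizer.coe ℂ (α f) : DoubleCentralizer ℂ (C0K X H)) =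
      U * DoubleCentralizer.coe ℂ (β f) * star U

/-- `α` and `β` are homotopic: they are connected by a path of `C₀(X)`-endomorphisms, continuous
in the point-norm topology. -/
def Homotopic (α β : C0End X H) : Prop := Joined α β

end Vect

end CXEnd

end

/-!
Everything is reduced to one intermediate notion: a *unitary field* from `β` to `α`, that is, a
strongly continuous family of unitaries `u x` on `H` with `u x β_x(A) = α_x(A) u x` for all `x` and
`A` (`FieldEquivalent`).

*Multipliers.* Strong convergence of bounded operators becomes norm convergence after multiplication
by a compact operator (`tendsto_mul_of_isCompactOperator`), so a strongly continuous family of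
unitaries multiplies `C₀(X) ⊗ K` into itself and is a unitary multiplier. Conversely, a multiplier
`U` acts fiber by fiber, by `u x ξ = U(ξ ⊗ e*)(x) e`. Hence `α = Ad U ∘ β` for a unitary multiplier
if and only if there is a unitary field (`FieldEquivalent.innerEquivalent`,
`InnerEquivalent.fieldEquivalent`).

*Reduction to projections.* Fix a unit vector `e` and the projection `p` onto its span. Since `α`
and `β` preserve approximate units, the `α_x` and `β_x` are nondegenerate. A partial isometry `w` from
`β_x(p) H` onto `α_x(p) H` therefore extends to the unitary `∑ᵢ α_x(bᵢ ⊗ e*) w β_x(e ⊗ bᵢ*)`, for an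
orthonormal basis `(bᵢ)`, and this extension depends strongly continuously on `x` if `w` depends
norm continuously on it. By polar decomposition a norm continuous family of merely invertible operators
from `β_x(p) H` to `α_x(p) H` suffices (`fieldEquivalent_of_invertible`).

*Bundles.* The evaluation `T ↦ T e` identifies the fiber of `vect(α)` over `x` with the range of
`α_x(p)`, which has finite dimension. An isomorphism `vect(α) ≅ vect(β)` thus gives a family of
invertible operators between these ranges, strongly continuous at first, but then norm continuous
because the ranges have finite dimension and vary norm continuously
(`continuous_of_mul_projection`). Conversely, composition with the adjoint of a unitary field is an
isometric isomorphism of bundles.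

*Homotopies.* A homotopy `(α_t)` gives the norm continuous family of projections `α_{t,x}(p)`. Close
projections are conjugate by the invertible element `q p + (1 - q) (1 - p)`; the product of these
over a sufficiently fine subdivision of `[0, 1]` conjugates `α_{0,x}(p)` to `α_{1,x}(p)`. For the
product to be continuous in `x` the mesh has to be a continuous function of `x`. It can be chosen on
the metric space of all paths, by a partition of unity, which is why `X` need not be paracompact
(`exists_continuous_transport`). Conversely, if `H` has infinite dimension, it is isomorphic to
`L²[0, ∞)`, and the shift semigroup there gives isometries `V` with which every strongly continuous
family of unitaries is contracted to `1` along `V u V* + (1 - V V*)` (`FieldEquivalent.homotopic`).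
-/

noncomputable section

namespace CXEnd

/-! ### Compact operators and their representations -/

section Compact

variable {H : Type*} [NormedAddCommGroup H] [InnerProductSpace ℂ H] [CompleteSpace H]

omit [CompleteSpace H] in
theorem isCompactOperator_rankOne (ξ η : H) :
    IsCompactOperator (InnerProductSpace.rankOne ℂ ξ η : H →L[ℂ] H) := by
  have h : IsCompactOperator (ContinuousLinearMap.toSpanSingleton ℂ ξ : ℂ →L[ℂ] H) := by
    refine ⟨ContinuousLinearMap.toSpanSingleton ℂ ξ '' Metric.closedBall 0 1,
      (isCompact_closedBall _ _).image (ContinuousLinearMap.continuous _), ?_⟩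
    exact mem_of_superset (Metric.closedBall_mem_nhds 0 one_pos) (Set.subset_preimage_image _ _)
  rw [InnerProductSpace.rankOne_def']
  exact h.comp_clm _

/-- The rank one operator `ζ ↦ ⟪η, ζ⟫ ξ` as an element of `𝒦 H`. -/
def rankOneK (ξ η : H) : 𝒦 H := ⟨InnerProductSpace.rankOne ℂ ξ η, isCompactOperator_rankOne ξ η⟩

@[simp] theorem rankOneK_apply (ξ η ζ : H) : (rankOneK ξ η).1 ζ = ⟪η, ζ⟫_ℂ • ξ := rfl

theorem 𝒦.ext {A B : 𝒦 H} (h : ∀ ζ, A.1 ζ = B.1 ζ) : A = B :=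
  Subtype.ext (ContinuousLinearMap.ext h)

@[simp] theorem 𝒦.coe_mul (A B : 𝒦 H) : (A * B).1 = A.1 * B.1 := rfl
@[simp] theorem 𝒦.coe_add (A B : 𝒦 H) : (A + B).1 = A.1 + B.1 := rfl
@[simp] theorem 𝒦.coe_sub (A B : 𝒦 H) : (A - B).1 = A.1 - B.1 := rfl
@[simp] theorem 𝒦.coe_zero : (0 : 𝒦 H).1 = 0 := rfl
@[simp] theorem 𝒦.coe_smul (c : ℂ) (A : 𝒦 H) : (c • A).1 = c • A.1 := rfl
@[simp] theorem 𝒦.coe_star (A : 𝒦 H) : (star A).1 = star A.1 := rfl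

theorem 𝒦.continuous_coe : Continuous (fun A : 𝒦 H => A.1) := continuous_subtype_val

/-- The inclusion of the compact operators into the bounded operators. -/
def inclK (H : Type*) [NormedAddCommGroup H] [InnerProductSpace ℂ H] [CompleteSpace H] :
    𝒦 H →⋆ₙₐ[ℂ] (H →L[ℂ] H) where
  toFun A := A.1
  map_smul' _ _ := rfl
  map_zero' := rfl
  map_add' _ _ := rfl
  map_mul' _ _ := rfl
  map_star' _ := rfl

theorem mul_rankOneK (A : 𝒦 H) (ξ η : H) : A * rankOneK ξ η = rankOneK (A.1 ξ) η :=
  𝒦.ext fun ζ => by simp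

theorem rankOneK_mul_rankOneK (a b c d : H) :
    rankOneK a b * rankOneK c d = ⟪b, c⟫_ℂ • rankOneK a d :=
  𝒦.ext fun ζ => by simp [smul_smul, mul_comm]

theorem star_rankOneK (a b : H) : star (rankOneK a b) = rankOneK b a :=
  Subtype.ext (InnerProductSpace.adjoint_rankOne (𝕜 := ℂ) a b)

theorem rankOneK_mul_self {e : H} (he : ‖e‖ = 1) (ξ : H) :
    rankOneK ξ e * rankOneK e e = rankOneK ξ e := by
  rw [rankOneK_mul_rankOneK, inner_self_eq_norm_sq_to_K, he]
  simp

theorem rankOneK_add_left (a b c : H) : rankOneK (a + b) c = rankOneK a c + rankOneK b c :=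
  𝒦.ext fun ζ => by simp

theorem rankOneK_smul_left (z : ℂ) (a c : H) : rankOneK (z • a) c = z • rankOneK a c :=
  𝒦.ext fun ζ => by simp [smul_smul, mul_comm]

theorem norm_rankOneK (a b : H) : ‖rankOneK a b‖ = ‖a‖ * ‖b‖ :=
  InnerProductSpace.norm_rankOne (𝕜 := ℂ) a b

theorem rankOneK_sub_left (a b c : H) : rankOneK (a - b) c = rankOneK a c - rankOneK b c :=
  𝒦.ext fun ζ => by simp [smul_sub]

/-- On a bounded family of operators, strong convergence becomes norm convergence after
multiplication from the right by a norm convergent family with compact limit: the limit maps the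
unit ball to a totally bounded set. -/
theorem tendsto_mul_of_isCompactOperator {ι : Type*} {l : Filter ι} {T : ι → H →L[ℂ] H}
    {T₀ : H →L[ℂ] H} {C : ℝ} (hC : ∀ᶠ i in l, ‖T i‖ ≤ C)
    (hT : ∀ ξ, Tendsto (fun i => T i ξ) l (𝓝 (T₀ ξ)))
    {k : ι → H →L[ℂ] H} {K : H →L[ℂ] H} (hk : Tendsto k l (𝓝 K)) (hK : IsCompactOperator K) :
    Tendsto (fun i => T i * k i) l (𝓝 (T₀ * K)) := by
  have h1 : Tendsto (fun i => T i * K) l (𝓝 (T₀ * K)) := by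
    rw [Metric.tendsto_nhds]
    intro ε hε
    have htb : TotallyBounded (K '' Metric.closedBall 0 1) :=
      (IsCompactOperator.isCompact_closure_image_closedBall
        (f := (K : H →ₗ[ℂ] H)) hK 1).totallyBounded.subset subset_closure
    have hB : 0 < |C| + ‖T₀‖ + 1 := by positivity
    obtain ⟨t, htf, ht⟩ := Metric.totallyBounded_iff.1 htb (ε / 4 / (|C| + ‖T₀‖ + 1))
      (by positivity)
    have hev : ∀ᶠ i in l, ∀ y ∈ t, ‖T i y - T₀ y‖ < ε / 4 := by
      rw [Filter.eventually_all_finite htf]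
      intro y _
      have := (Metric.tendsto_nhds.1 (hT y)) (ε / 4) (by positivity)
      simpa [dist_eq_norm] using this
    filter_upwards [hC, hev] with i hCi hi
    rw [dist_eq_norm, ← sub_mul]
    refine lt_of_le_of_lt (b := ε / 2) ?_ (by linarith)
    refine ContinuousLinearMap.opNorm_le_of_unit_norm (by positivity) fun ξ hξ => ?_
    have hm : K ξ ∈ K '' Metric.closedBall 0 1 := ⟨ξ, by simp [hξ], rfl⟩
    obtain ⟨y, hy, hyd⟩ := Set.mem_iUnion₂.1 (ht hm)
    rw [Metric.mem_ball, dist_eq_norm] at hyd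
    have e : ((T i - T₀) * K) ξ = (T i - T₀) (K ξ - y) + (T i y - T₀ y) := by
      simp only [mul_apply_eq_comp, map_sub, sub_apply]
      abel
    have hTn : ‖T i - T₀‖ ≤ |C| + ‖T₀‖ + 1 := by
      have := norm_sub_le (T i) T₀
      have := le_abs_self C
      linarith
    calc ‖((T i - T₀) * K) ξ‖ ≤ ‖(T i - T₀) (K ξ - y)‖ + ‖T i y - T₀ y‖ := by
          rw [e]; exact norm_add_le _ _
      _ ≤ (|C| + ‖T₀‖ + 1) * (ε / 4 / (|C| + ‖T₀‖ + 1)) + ε / 4 := by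
          refine add_le_add ?_ (hi y hy).le
          exact (T i - T₀).le_of_opNorm_le_of_le hTn hyd.le
      _ = ε / 2 := by field_simp; ring
  have h2 : Tendsto (fun i => T i * (k i - K)) l (𝓝 0) := by
    have h3 : Tendsto (fun i => C * ‖k i - K‖) l (𝓝 0) := by
      simpa using ((tendsto_iff_norm_sub_tendsto_zero.1 hk).const_mul C)
    refine squeeze_zero_norm' ?_ h3
    filter_upwards [hC] with i hi
    exact (norm_mul_le _ _).trans (by gcongr)
  simpa [mul_sub] using h2.add h1

/-- A representation of the compact operators is nondegenerate if every vector lies in the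
closure of its orbit. -/
def IsNondegenerate (π : 𝒦 H →⋆ₙₐ[ℂ] (H →L[ℂ] H)) : Prop :=
  ∀ ζ : H, ∀ ε > 0, ∃ A : 𝒦 H, ‖π A ζ - ζ‖ < ε

/-- The representation of the compact operators on `H` given by an endomorphism. -/
def rep (φ : 𝒦 H →⋆ₙₐ[ℂ] 𝒦 H) : 𝒦 H →⋆ₙₐ[ℂ] (H →L[ℂ] H) := (inclK H).comp φ

theorem norm_rep_le (π : 𝒦 H →⋆ₙₐ[ℂ] (H →L[ℂ] H)) (A : 𝒦 H) : ‖π A‖ ≤ ‖A‖ :=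
  NonUnitalStarAlgHom.norm_apply_le π A

variable {ι : Type*} (b : HilbertBasis ι ℂ H)

/-- The orthogonal projection onto the span of finitely many basis vectors. -/
def basisProj (s : Finset ι) : 𝒦 H := ∑ i ∈ s, rankOneK (b i) (b i)

theorem 𝒦.coe_sum {κ : Type*} (s : Finset κ) (f : κ → 𝒦 H) :
    (∑ i ∈ s, f i).1 = ∑ i ∈ s, (f i).1 :=
  map_sum (inclK H) f s

theorem basisProj_apply (s : Finset ι) (ξ : H) :
    (basisProj b s).1 ξ = ∑ i ∈ s, ⟪b i, ξ⟫_ℂ • b i := by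
  simp [basisProj, 𝒦.coe_sum]

theorem tendsto_basisProj_apply (ξ : H) :
    Tendsto (fun s => (basisProj b s).1 ξ) atTop (𝓝 ξ) := by
  have h := b.hasSum_repr ξ
  simp only [HilbertBasis.repr_apply_apply] at h
  simp only [basisProj_apply]
  exact h

theorem star_basisProj (s : Finset ι) : star (basisProj b s) = basisProj b s := by
  simp [basisProj, star_rankOneK]

theorem basisProj_mul_self (s : Finset ι) : basisProj b s * basisProj b s = basisProj b s := by
  classical
  simp only [basisProj, Finset.sum_mul_sum, rankOneK_mul_rankOneK,
    orthonormal_iff_ite.1 b.orthonormal, ite_smul, one_smul, zero_smul]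
  exact Finset.sum_congr rfl fun i hi => by simp [hi]

theorem norm_basisProj_le (s : Finset ι) : ‖basisProj b s‖ ≤ 1 := by
  have h := CStarRing.norm_star_mul_self (x := basisProj b s)
  rw [star_basisProj, basisProj_mul_self] at h
  nlinarith [norm_nonneg (basisProj b s)]

/-- A nondegenerate representation carries the finite basis projections to a net converging
strongly to `1`. -/
theorem IsNondegenerate.tendsto_basisProj {π : 𝒦 H →⋆ₙₐ[ℂ] (H →L[ℂ] H)}
    (hπ : IsNondegenerate π) (ζ : H) :
    Tendsto (fun s => π (basisProj b s) ζ) atTop (𝓝 ζ) := by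
  rw [Metric.tendsto_nhds]
  intro ε hε
  obtain ⟨A, hA⟩ := hπ ζ (ε / 4) (by positivity)
  have h1 : Tendsto (fun s => basisProj b s * A) atTop (𝓝 A) := by
    have := tendsto_mul_of_isCompactOperator (T := fun s => (basisProj b s).1) (T₀ := 1) (C := 1)
      (Eventually.of_forall (norm_basisProj_le b)) (fun ξ => tendsto_basisProj_apply b ξ)
      (tendsto_const_nhds (x := A.1)) A.2
    rw [one_mul] at this
    exact tendsto_subtype_rng.2 this
  have h2 := (tendsto_iff_norm_sub_tendsto_zero.1 h1).mul_const ‖ζ‖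
  rw [zero_mul] at h2
  filter_upwards [h2.eventually (gt_mem_nhds (show (0 : ℝ) < ε / 4 by positivity))] with s hs
  rw [dist_eq_norm]
  have e : π (basisProj b s) ζ - ζ = (π A ζ - ζ) + π (basisProj b s * A - A) ζ
      - π (basisProj b s) (π A ζ - ζ) := by
    simp
  have n1 : ‖π (basisProj b s * A - A) ζ‖ < ε / 4 :=
    (((π _).le_opNorm ζ).trans (by gcongr; exact norm_rep_le π _)).trans_lt hs
  have n2 : ‖π (basisProj b s) (π A ζ - ζ)‖ ≤ ‖π A ζ - ζ‖ := by
    have := (π (basisProj b s)).le_of_opNorm_le ((norm_rep_le π _).trans (norm_basisProj_le b s))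
      (π A ζ - ζ)
    simpa using this
  rw [e]
  have := norm_sub_le ((π A ζ - ζ) + π (basisProj b s * A - A) ζ)
    (π (basisProj b s) (π A ζ - ζ))
  have := norm_add_le (π A ζ - ζ) (π (basisProj b s * A - A) ζ)
  linarith

/-- Operators that agree after composition with the images of all rank one operators under a
nondegenerate representation are equal. -/
theorem IsNondegenerate.ext {π : 𝒦 H →⋆ₙₐ[ℂ] (H →L[ℂ] H)} (hπ : IsNondegenerate π)
    {S T : H →L[ℂ] H} (h : ∀ ξ η, S * π (rankOneK ξ η) = T * π (rankOneK ξ η)) : S = T := by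
  obtain ⟨w, b, -⟩ := exists_hilbertBasis ℂ H
  ext ζ
  have h1 (s) : S (π (basisProj b s) ζ) = T (π (basisProj b s) ζ) := by
    have : S * π (basisProj b s) = T * π (basisProj b s) := by
      simp only [basisProj, map_sum, Finset.mul_sum, h]
    exact congr($this ζ)
  have h2 := hπ.tendsto_basisProj b ζ
  refine tendsto_nhds_unique ((S.continuous.tendsto ζ).comp h2) ?_
  simpa only [Function.comp_def, h1] using (T.continuous.tendsto ζ).comp h2

end Compact

/-! ### The fibers of an endomorphism -/

section Fiber

variable {X : Type*} [TopologicalSpace X] [LocallyCompactSpace X] [T2Space X]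
  {H : Type*} [NormedAddCommGroup H] [InnerProductSpace ℂ H] [CompleteSpace H]

/-- Elements of `C₀(X) ⊗ K` can be prescribed to be constant near a point. -/
theorem exists_eventually_eq (x : X) (a : 𝒦 H) : ∃ f : C0K X H, ∀ᶠ y in 𝓝 x, f y = a := by
  obtain ⟨K, hK, hxK⟩ := exists_compact_mem_nhds x
  obtain ⟨g, hg1, -, hgc, -⟩ := exists_continuous_one_zero_of_isCompact
    hK isClosed_empty (Set.disjoint_empty _)
  refine ⟨⟨⟨fun y => ((g y : ℝ) : ℂ) • a, by fun_prop⟩, ?_⟩, ?_⟩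
  · have h := hgc.is_zero_at_infty
    have h2 : Tendsto (fun y => ((g y : ℝ) : ℂ)) (cocompact X) (𝓝 0) := by
      simpa [Function.comp_def] using (Complex.continuous_ofReal.tendsto 0).comp h
    simpa using h2.smul_const a
  · filter_upwards [hxK] with y hy
    change ((g y : ℝ) : ℂ) • a = a
    simp [hg1 hy]

omit [LocallyCompactSpace X] [T2Space X] in
theorem norm_apply_le (f : C0K X H) (x : X) : ‖f x‖ ≤ ‖f‖ := by
  rw [← ZeroAtInftyContinuousMap.norm_toBCF_eq_norm]
  exact f.toBCF.norm_coe_le_norm x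

omit [LocallyCompactSpace X] [T2Space X] in
theorem continuous_eval_C0K : Continuous fun p : C0K X H × X => p.1 p.2 := by
  have h : Continuous fun p : C0K X H × X => (p.1.toBCF) p.2 :=
    (ZeroAtInftyContinuousMap.isometry_toBCF.continuous.comp continuous_fst).eval continuous_snd
  exact h

/-- The endomorphism of the fiber over `x` induced by a continuous family of
`C₀(X)`-endomorphisms depends continuously on the parameter and on `x` jointly. -/
theorem continuous_fiber_family {Y : Type*} [TopologicalSpace Y] {γ : Y → C0End X H}
    (hγ : Continuous γ) (a : 𝒦 H) : Continuous fun p : Y × X => fiber (γ p.1) p.2 a := by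
  rw [continuous_iff_continuousAt]
  rintro ⟨y, x⟩
  obtain ⟨f, hf⟩ := exists_eventually_eq x a
  have h1 : Continuous fun y => γ y f := 
    (continuous_apply f).comp
      ((continuous_induced_dom (f := fun (α : C0End X H) (f : C0K X H) => α f)).comp hγ)
  have h2 : Continuous fun p : Y × X => (γ p.1 f) p.2 :=
    continuous_eval_C0K.comp ((h1.comp continuous_fst).prodMk continuous_snd)
  refine h2.continuousAt.congr ?_
  filter_upwards [(continuous_snd.tendsto (y, x)).eventually hf] with p hp
  rw [apply_eq_fiber, hp]

theorem continuous_fiber (α : C0End X H) (a : 𝒦 H) : Continuous fun x => fiber α x a :=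
  (continuous_fiber_family (Y := Unit) (continuous_const (y := α)) a).comp
    ((continuous_const (y := ())).prodMk continuous_id)

theorem continuous_rep_fiber (α : C0End X H) (a : 𝒦 H) :
    Continuous fun x => rep (fiber α x) a :=
  𝒦.continuous_coe.comp (continuous_fiber α a)

/-- The fibers of a `C₀(X)`-endomorphism are nondegenerate, since it maps the canonical
approximate unit to an approximate unit. -/
theorem isNondegenerate_rep_fiber (α : C0End X H) (x : X) :
    IsNondegenerate (rep (fiber α x)) := by
  intro ζ ε hε
  let _ : NonUnitalCStarAlgebra (C0K X H) := { }
  let _ := CStarAlgebra.spectralOrder (C0K X H)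
  have := CStarAlgebra.spectralOrderedRing (C0K X H)
  have hl := α.map_approximateUnit _
    (CStarAlgebra.increasingApproximateUnit (C0K X H)).toIsApproximateUnit
  have hne := hl.neBot
  by_cases hζ : ζ = 0
  · exact ⟨0, by simpa [hζ] using hε⟩
  have hζ' : 0 < ‖ζ‖ := norm_pos_iff.2 hζ
  -- the approximate unit is tested on an `f` with `f x = ζ ⊗ ζ*`, so that
  -- `(α g * f - f) x = (α_x(g x) ζ - ζ) ⊗ ζ*`
  let f : C0K X H := lift x (rankOneK ζ ζ)
  have h := hl.tendsto_mul_right f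
  rw [tendsto_map'_iff] at h
  obtain ⟨g, hg⟩ := ((Metric.tendsto_nhds.1 h) (ε * ‖ζ‖) (by positivity)).exists
  refine ⟨g x, ?_⟩
  rw [Function.comp_apply, dist_eq_norm] at hg
  have h1 : ‖(α g * f - f) x‖ < ε * ‖ζ‖ := (norm_apply_le _ _).trans_lt hg
  have h2 : (α g * f - f) x = rankOneK (rep (fiber α x) (g x) ζ - ζ) ζ := by
    have e : (α g * f - f) x = α g x * f x - f x := rfl
    rw [e, apply_eq_fiber, lift_apply, mul_rankOneK, rankOneK_sub_left]
    rfl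
  rw [h2, norm_rankOneK] at h1
  exact lt_of_mul_lt_mul_right h1 hζ'.le

end Fiber

/-! ### Unitary intertwiners of representations of the compact operators -/

section Intertwiner

variable {H : Type*} [NormedAddCommGroup H] [InnerProductSpace ℂ H] [CompleteSpace H]
  {ι : Type*} (b : HilbertBasis ι ℂ H)

/-- The finite partial sums `∑ᵢ π(bᵢ ⊗ e*) w ρ(e ⊗ bᵢ*)` of the intertwiner from `ρ` to `π` that is
determined by an operator `w` from the range of `ρ(e ⊗ e*)` to the range of `π(e ⊗ e*)`. -/
def partialIntertwiner (π ρ : 𝒦 H →⋆ₙₐ[ℂ] (H →L[ℂ] H)) (e : H) (w : H →L[ℂ] H)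
    (s : Finset ι) : H →L[ℂ] H :=
  ∑ i ∈ s, π (rankOneK (b i) e) * w * ρ (rankOneK e (b i))

theorem norm_star_mul_self_apply_sq (T : H →L[ℂ] H) (ζ : H) :
    ‖T ζ‖ ^ 2 ≤ ‖(star T * T) ζ‖ * ‖ζ‖ := by
  have h := ContinuousLinearMap.apply_norm_sq_eq_inner_adjoint_left T ζ
  rw [h]
  exact (RCLike.re_le_norm _).trans (norm_inner_le_norm _ _)

theorem norm_apply_of_star_mul_self {T : H →L[ℂ] H} (h : star T * T = 1) (ζ : H) :
    ‖T ζ‖ = ‖ζ‖ :=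
  (ContinuousLinearMap.norm_map_iff_adjoint_comp_self T).2 h ζ

variable {π ρ : 𝒦 H →⋆ₙₐ[ℂ] (H →L[ℂ] H)} {e : H} {w : H →L[ℂ] H}

/-- The terms of a partial sum have orthogonal ranges and orthogonal supports. -/
theorem star_partialIntertwiner_mul_self (he : ‖e‖ = 1)
    (hw₁ : star w * w = ρ (rankOneK e e)) (hw₂ : π (rankOneK e e) * w = w) (s : Finset ι) :
    star (partialIntertwiner b π ρ e w s) * partialIntertwiner b π ρ e w s
      = ρ (basisProj b s) := by
  classical
  have hee : ⟪e, e⟫_ℂ = 1 := by simp [inner_self_eq_norm_sq_to_K, he]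
  simp only [partialIntertwiner, star_sum, Finset.sum_mul_sum]
  have key (i j : ι) : star (π (rankOneK (b i) e) * w * ρ (rankOneK e (b i))) *
      (π (rankOneK (b j) e) * w * ρ (rankOneK e (b j)))
      = if i = j then ρ (rankOneK (b i) (b i)) else 0 := by
    have h1 : star (π (rankOneK (b i) e) * w * ρ (rankOneK e (b i))) *
      (π (rankOneK (b j) e) * w * ρ (rankOneK e (b j)))
      = ρ (rankOneK (b i) e) * (star w * (π (rankOneK e (b i) * rankOneK (b j) e) * w))
        * ρ (rankOneK e (b j)) := by
      simp only [star_mul, ← map_star, star_rankOneK, map_mul, mul_assoc]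
    rw [h1, rankOneK_mul_rankOneK, orthonormal_iff_ite.1 b.orthonormal]
    split_ifs with hij
    · subst hij
      rw [one_smul, hw₂, hw₁, ← map_mul, ← map_mul, rankOneK_mul_rankOneK, hee, one_smul,
        rankOneK_mul_rankOneK, hee, one_smul]
    · simp
  simp only [key, basisProj, map_sum]
  exact Finset.sum_congr rfl fun i hi => by simp [hi]

theorem partialIntertwiner_mul (s : Finset ι) (ξ η : H) :
    partialIntertwiner b π ρ e w s * ρ (rankOneK ξ η)
      = π (rankOneK ((basisProj b s).1 ξ) e) * w * ρ (rankOneK e η) := by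
  rw [← mul_rankOneK, basisProj, partialIntertwiner]
  simp only [Finset.sum_mul, map_sum]
  refine Finset.sum_congr rfl fun i _ => ?_
  rw [mul_assoc, ← map_mul, rankOneK_mul_rankOneK, rankOneK_mul_rankOneK]
  simp only [map_smul, mul_smul_comm, smul_mul_assoc]

/-- Two nondegenerate representations `π` and `ρ` of the compact operators are unitarily
equivalent as soon as there is a partial isometry `w` from the range of `ρ(p)` onto the range of
`π(p)`, for `p` the projection onto the line spanned by a unit vector `e`. The bound says how fast
the partial sums converge to the intertwining unitary. -/
theorem exists_unitary_intertwiner (hπ : IsNondegenerate π) (hρ : IsNondegenerate ρ)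
    (he : ‖e‖ = 1) (hw₁ : star w * w = ρ (rankOneK e e)) (hw₂ : w * star w = π (rankOneK e e))
    (hw₃ : w * ρ (rankOneK e e) = w) :
    ∃ u ∈ unitary (H →L[ℂ] H), (∀ A, u * ρ A = π A * u) ∧
      ∀ s ζ, ‖u ζ - partialIntertwiner b π ρ e w s ζ‖ ^ 2 ≤ ‖ζ - ρ (basisProj b s) ζ‖ * ‖ζ‖ := by
  classical
  have hee : ⟪e, e⟫_ℂ = 1 := by simp [inner_self_eq_norm_sq_to_K, he]
  have hw₄ : π (rankOneK e e) * w = w := by rw [← hw₂, mul_assoc, hw₁, hw₃]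
  set v := partialIntertwiner b π ρ e w with hv
  have hvv (s) : star (v s) * v s = ρ (basisProj b s) :=
    star_partialIntertwiner_mul_self b he hw₁ hw₄ s
  -- the tail of the partial sums over `t \ s` has the square `ρ(basisProj b (t \ s))`
  have hdiff {s t : Finset ι} (hst : s ⊆ t) (ζ : H) :
      ‖v t ζ - v s ζ‖ ^ 2 ≤ ‖ρ (basisProj b t) ζ - ρ (basisProj b s) ζ‖ * ‖ζ‖ := by
    have h1 : v (t \ s) = v t - v s := by
      rw [eq_sub_iff_add_eq]; exact Finset.sum_sdiff hst
    have h2 : basisProj b (t \ s) = basisProj b t - basisProj b s := by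
      rw [eq_sub_iff_add_eq]; exact Finset.sum_sdiff hst
    have h3 := norm_star_mul_self_apply_sq (v (t \ s)) ζ
    rw [hvv, h1, h2, map_sub] at h3
    exact h3
  have hvn (s) : ‖v s‖ ≤ 1 := by
    have h := CStarRing.norm_star_mul_self (x := v s)
    have h2 := (norm_rep_le ρ (basisProj b s)).trans (norm_basisProj_le b s)
    rw [← hvv, h] at h2
    nlinarith [norm_nonneg (v s)]
  have hcauchy (ζ : H) : CauchySeq fun s => v s ζ := by
    rw [Metric.cauchySeq_iff']
    intro ε hε
    have hlim := (hρ.tendsto_basisProj b ζ)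
    have hz : 0 < ‖ζ‖ + 1 := by positivity
    obtain ⟨s, hs⟩ := Metric.cauchySeq_iff'.1 hlim.cauchySeq (ε ^ 2 / (‖ζ‖ + 1)) (by positivity)
    refine ⟨s, fun t ht => ?_⟩
    have h1 := hdiff ht ζ
    have h2 := hs t ht
    rw [dist_eq_norm] at h2 ⊢
    refine lt_of_pow_lt_pow_left₀ 2 hε.le (h1.trans_lt ?_)
    calc _ ≤ ‖ρ (basisProj b t) ζ - ρ (basisProj b s) ζ‖ * (‖ζ‖ + 1) := by gcongr; linarith
      _ < ε ^ 2 / (‖ζ‖ + 1) * (‖ζ‖ + 1) := by gcongr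
      _ = ε ^ 2 := by field_simp
  choose f hf using fun ζ => cauchySeq_tendsto_of_complete (hcauchy ζ)
  let u : H →L[ℂ] H := ContinuousLinearMap.ofTendstoOfBoundedRange f v (tendsto_pi_nhds.2 hf)
    (isBounded_iff_forall_norm_le.2 ⟨1, by rintro _ ⟨s, rfl⟩; exact hvn s⟩)
  have hu (ζ : H) : Tendsto (fun s => v s ζ) atTop (𝓝 (u ζ)) := hf ζ
  have hbound (s) (ζ : H) : ‖u ζ - v s ζ‖ ^ 2 ≤ ‖ζ - ρ (basisProj b s) ζ‖ * ‖ζ‖ := by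
    refine le_of_tendsto_of_tendsto (((hu ζ).sub_const (v s ζ)).norm.pow 2)
      (((hρ.tendsto_basisProj b ζ).sub_const _).norm.mul_const ‖ζ‖) ?_
    filter_upwards [eventually_ge_atTop s] with t ht using hdiff ht ζ
  -- the net of partial sums is explicit on the images of the rank one operators
  have huθ (ξ η : H) : u * ρ (rankOneK ξ η) = π (rankOneK ξ e) * w * ρ (rankOneK e η) := by
    ext ζ
    refine tendsto_nhds_unique (hu (ρ (rankOneK ξ η) ζ)) ?_
    have h1 (s) : v s (ρ (rankOneK ξ η) ζ)
        = (π (rankOneK ((basisProj b s).1 ξ) e) * w * ρ (rankOneK e η)) ζ :=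
      congr($(partialIntertwiner_mul b s ξ η) ζ)
    simp only [h1]
    have h2 : Continuous fun ξ => π (rankOneK ξ e) := by
      refine continuous_iff_continuousAt.2 fun x => tendsto_iff_norm_sub_tendsto_zero.2 ?_
      have h3 : Tendsto (fun y => ‖y - x‖ * ‖e‖) (𝓝 x) (𝓝 0) := by
        simpa using (tendsto_iff_norm_sub_tendsto_zero.1 (tendsto_id (x := 𝓝 x))).mul_const ‖e‖
      refine squeeze_zero (fun _ => norm_nonneg _) (fun y => ?_) h3
      rw [← map_sub, ← rankOneK_sub_left, ← norm_rankOneK]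
      exact norm_rep_le π _
    have h3 := (h2.tendsto ξ).comp (tendsto_basisProj_apply b ξ)
    exact ((ContinuousLinearMap.apply ℂ H ζ).continuous.tendsto _).comp
      ((h3.mul_const w).mul_const (ρ (rankOneK e η)))
  have huu : star u * u = 1 := by
    refine (ContinuousLinearMap.norm_map_iff_adjoint_comp_self u).1 fun ζ => ?_
    have h1 : Tendsto (fun s => ‖v s ζ‖ ^ 2) atTop (𝓝 (‖ζ‖ ^ 2)) := by
      have h2 (s) : ‖v s ζ‖ ^ 2 = RCLike.re ⟪ρ (basisProj b s) ζ, ζ⟫_ℂ := by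
        rw [ContinuousLinearMap.apply_norm_sq_eq_inner_adjoint_left, ← hvv]; rfl
      simp only [h2]
      rw [← inner_self_eq_norm_sq (𝕜 := ℂ)]
      exact (RCLike.continuous_re.tendsto _).comp
        ((hρ.tendsto_basisProj b ζ).inner tendsto_const_nhds)
    have h3 := tendsto_nhds_unique ((hu ζ).norm.pow 2) h1
    exact (sq_eq_sq₀ (norm_nonneg _) (norm_nonneg _)).1 h3
  have huu' : u * star u = 1 := by
    refine hπ.ext fun ξ η => ?_
    have h1 : u * (ρ (rankOneK ξ e) * star w) = π (rankOneK ξ e) := by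
      rw [← mul_assoc, huθ, mul_assoc (_ * _), mul_assoc, ← mul_assoc w, hw₃, hw₂, ← map_mul,
        rankOneK_mul_rankOneK, hee, one_smul]
    have h2 : π (rankOneK ξ η) = u * ((ρ (rankOneK ξ e) * star w) * π (rankOneK e η)) := by
      rw [← mul_assoc, h1, ← map_mul, rankOneK_mul_rankOneK, hee, one_smul]
    rw [h2, mul_assoc, ← mul_assoc (star u), huu, one_mul, one_mul]
  refine ⟨u, ⟨huu, huu'⟩, fun A => ?_, hbound⟩
  refine hρ.ext fun ξ η => ?_
  rw [mul_assoc, ← map_mul, mul_rankOneK, huθ, mul_assoc (π A), huθ, ← mul_rankOneK, map_mul]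
  simp only [mul_assoc]

end Intertwiner

/-! ### Polar decomposition between ranges of projections -/

section Polar

variable {H : Type*} [NormedAddCommGroup H] [InnerProductSpace ℂ H] [CompleteSpace H]

/-- If `L` is an invertible map from the range of the projection `P` to the range of the projection
`Q`, with inverse `M`, then its polar part `L (L* L)^{-1/2}` is a partial isometry from the range of
`P` onto that of `Q`. Since `M M* + 1 - P` inverts `L* L + 1 - P`, the polar part can be written
with a square root and without inverses. -/
theorem polar_part {P Q L M : H →L[ℂ] H} (hP : star P = P) (hPP : P * P = P) (hQ : star Q = Q)
    (hQQ : Q * Q = Q) (hLP : L * P = L) (hPM : P * M = M) (hML : M * L = P) (hLM : L * M = Q) :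
    0 ≤ M * star M + (1 - P) ∧
    star (L * CFC.sqrt (M * star M + (1 - P))) * (L * CFC.sqrt (M * star M + (1 - P))) = P ∧
    (L * CFC.sqrt (M * star M + (1 - P))) * star (L * CFC.sqrt (M * star M + (1 - P))) = Q ∧
    L * CFC.sqrt (M * star M + (1 - P)) * P = L * CFC.sqrt (M * star M + (1 - P)) := by
  set N := M * star M + (1 - P) with hN
  have hPL : P * star L = star L := by
    have := congr(star $hLP); simpa [hP] using this
  have hMP : star M * P = star M := by
    have := congr(star $hPM); simpa [hP] using this
  have hQL : Q * L = L := by rw [← hLM, mul_assoc, hML, hLP]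
  have hMsL : star M * star L = Q := by rw [← star_mul, hLM, hQ]
  have hN0 : 0 ≤ N := by
    have h1 : (1 : H →L[ℂ] H) - P = star (1 - P) * (1 - P) := by
      simp [hP, mul_sub, sub_mul, hPP]
    rw [hN, h1]
    exact add_nonneg (mul_star_self_nonneg M) (star_mul_self_nonneg _)
  set S := CFC.sqrt N with hS
  have hSS : S * S = N := CFC.sqrt_mul_sqrt_self N hN0
  have hSstar : star S = S := (CFC.sqrt_nonneg N).isSelfAdjoint
  have hNP : Commute N P := by
    simp only [Commute, SemiconjBy, hN, add_mul, mul_add, sub_mul, mul_sub, mul_assoc, hMP, hPP]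
    rw [← mul_assoc P, hPM]
    simp
  have hSP : S * P = P * S := by
    have : Commute S P := hNP.cfcₙ_nnreal _
    exact this
  -- `N` is the inverse of `G = L* L + 1 - P`, so that `S` is `G ^ (-1/2)`
  have hNG : N * (star L * L + (1 - P)) = 1 := by
    have h1 : M * star M * (star L * L) = P := by
      rw [mul_assoc, ← mul_assoc (star M), hMsL, hQL, hML]
    have h2 : M * star M * (1 - P) = 0 := by rw [mul_assoc, mul_sub, mul_one, hMP]; simp
    have h3 : (1 - P) * (star L * L) = 0 := by rw [← mul_assoc, sub_mul, hPL]; simp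
    have h4 : (1 - P) * (1 - P) = 1 - P := by simp [mul_sub, sub_mul, hPP]
    rw [hN, add_mul, mul_add, mul_add, h1, h2, h3, h4]
    abel
  have hNstar : star N = N := hN0.isSelfAdjoint
  have hGN : (star L * L + (1 - P)) * N = 1 := by
    have := congr(star $hNG); simpa [hP, hNstar] using this
  have hLL : star L * L = (star L * L + (1 - P)) - (1 - P) := by abel
  set G := star L * L + (1 - P) with hG
  have hSG : G * S = S * G := by
    have hSN : S * N = N * S := by rw [← hSS, mul_assoc]
    calc G * S = G * S * (N * G) := by rw [hNG, mul_one]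
      _ = G * (S * N) * G := by simp only [mul_assoc]
      _ = (G * N) * S * G := by rw [hSN]; simp only [mul_assoc]
      _ = S * G := by rw [hGN, one_mul]
  have hPN : (1 - P) * N = 1 - P := by
    rw [hN, mul_add, ← mul_assoc, sub_mul, hPM]; simp [mul_sub, sub_mul, hPP]
  refine ⟨hN0, ?_, ?_, ?_⟩
  · have hSP' : S * (1 - P) = (1 - P) * S := by rw [mul_sub, sub_mul, hSP]; simp
    calc star (L * S) * (L * S) = S * (star L * L) * S := by
          rw [star_mul, hSstar]; simp only [mul_assoc]
      _ = G * (S * S) - (1 - P) * (S * S) := by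
          rw [hLL, mul_sub, sub_mul, ← hSG, hSP']; simp only [mul_assoc]
      _ = P := by rw [hSS, hGN, hPN]; abel
  · have hLP' : L * (1 - P) = 0 := by rw [mul_sub, hLP]; simp
    calc (L * S) * star (L * S) = L * (S * S) * star L := by
          rw [star_mul, hSstar]; simp only [mul_assoc]
      _ = (L * M) * (star M * star L) + L * (1 - P) * star L := by
          rw [hSS, hN, mul_add, add_mul]; simp only [mul_assoc]
      _ = Q := by rw [hLM, hMsL, hLP', zero_mul, add_zero, hQQ]
  · rw [mul_assoc, hSP, ← mul_assoc, hLP]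

end Polar

/-! ### Unitary fields between endomorphisms -/

section Field

variable {X : Type*} [TopologicalSpace X]
  {H : Type*} [NormedAddCommGroup H] [InnerProductSpace ℂ H] [CompleteSpace H]

/-- A strongly continuous family of unitaries on `H`, parametrized by `X`. These are the unitary
multipliers of `C₀(X) ⊗ K`. -/
structure IsUnitaryField (u : X → H →L[ℂ] H) : Prop where
  mem_unitary : ∀ x, u x ∈ unitary (H →L[ℂ] H)
  continuous_apply : ∀ ξ, Continuous fun x => u x ξ

namespace IsUnitaryField

variable {u : X → H →L[ℂ] H} (hu : IsUnitaryField u)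
include hu

theorem star_mul_self (x : X) : star (u x) * u x = 1 := (hu.mem_unitary x).1

theorem mul_star_self (x : X) : u x * star (u x) = 1 := (hu.mem_unitary x).2

theorem norm_apply (x : X) (ξ : H) : ‖u x ξ‖ = ‖ξ‖ :=
  norm_apply_of_star_mul_self (hu.star_mul_self x) ξ

theorem norm_le (x : X) : ‖u x‖ ≤ 1 :=
  ContinuousLinearMap.opNorm_le_bound _ zero_le_one fun ξ => by rw [hu.norm_apply, one_mul]

theorem apply_star_apply (x : X) (ξ : H) : u x (star (u x) ξ) = ξ := congr($(hu.mul_star_self x) ξ)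

/-- The adjoints of a strongly continuous family of unitaries are strongly continuous, because
`‖(u x)* ξ - (u y)* ξ‖ = ‖(u x - u y) (u y)* ξ‖`. -/
protected theorem star : IsUnitaryField fun x => star (u x) := by
  refine ⟨fun x => Unitary.star_mem (hu.mem_unitary x), fun ξ => ?_⟩
  refine continuous_iff_continuousAt.2 fun y => tendsto_iff_norm_sub_tendsto_zero.2 ?_
  have h := (tendsto_iff_norm_sub_tendsto_zero.1 ((hu.continuous_apply (star (u y) ξ)).tendsto y))
  refine h.congr fun x => ?_
  rw [hu.apply_star_apply, ← hu.norm_apply x (star (u x) ξ - star (u y) ξ), map_sub,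
    hu.apply_star_apply, norm_sub_rev]

/-- A strongly continuous family of unitaries acts jointly continuously. -/
theorem continuous_apply₂ {Y : Type*} [TopologicalSpace Y] {g : Y → X} {ξ : Y → H}
    (hg : Continuous g) (hξ : Continuous ξ) : Continuous fun y => u (g y) (ξ y) := by
  refine continuous_iff_continuousAt.2 fun y => tendsto_iff_norm_sub_tendsto_zero.2 ?_
  have h1 := tendsto_iff_norm_sub_tendsto_zero.1 (hξ.tendsto y)
  have h2 := tendsto_iff_norm_sub_tendsto_zero.1
    (((hu.continuous_apply (ξ y)).comp hg).tendsto y)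
  have h3 := h1.add h2
  rw [add_zero] at h3
  refine squeeze_zero (fun _ => norm_nonneg _) (fun z => ?_) h3
  have e : u (g z) (ξ z) - u (g y) (ξ y)
      = u (g z) (ξ z - ξ y) + (u (g z) (ξ y) - u (g y) (ξ y)) := by rw [map_sub]; abel
  rw [e]
  exact (norm_add_le _ _).trans (add_le_add (hu.norm_apply _ _).le le_rfl)

/-- Multiplying a norm continuous family of compact operators by a strongly continuous family of
unitaries gives a norm continuous family. -/
theorem continuous_mul {k : X → 𝒦 H} (hk : Continuous k) : Continuous fun x => u x * (k x).1 :=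
  continuous_iff_continuousAt.2 fun x =>
    tendsto_mul_of_isCompactOperator (Eventually.of_forall hu.norm_le)
      (fun ξ => (hu.continuous_apply ξ).tendsto x)
      ((𝒦.continuous_coe.comp hk).tendsto x) (k x).2

theorem continuous_mul_right {k : X → 𝒦 H} (hk : Continuous k) :
    Continuous fun x => (k x).1 * u x := by
  have h := (hu.star.continuous_mul (k := fun x => star (k x)) hk.star).star
  simpa [star_mul] using h

end IsUnitaryField

variable [LocallyCompactSpace X] [T2Space X]

/-- There is a strongly continuous family of unitaries that conjugates `β` to `α`, fiber by
fiber. -/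
def FieldEquivalent (α β : C0End X H) : Prop :=
  ∃ u : X → H →L[ℂ] H, IsUnitaryField u ∧
    ∀ x A, u x * rep (fiber β x) A = rep (fiber α x) A * u x

theorem fieldEquivalent_of_subsingleton [Subsingleton H] (α β : C0End X H) :
    FieldEquivalent α β :=
  ⟨fun _ => 1, ⟨fun _ => one_mem _, fun _ => continuous_const⟩, fun _ _ => Subsingleton.elim _ _⟩

/-- A continuous family of partial isometries between the ranges of `β_x(p)` and `α_x(p)`, `p` a
rank one projection, induces a strongly continuous family of unitaries between `β` and `α`. -/
theorem fieldEquivalent_of_partialIsometry {α β : C0End X H} {e : H} (he : ‖e‖ = 1)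
    {w : X → H →L[ℂ] H} (hw : Continuous w)
    (hw₁ : ∀ x, star (w x) * w x = rep (fiber β x) (rankOneK e e))
    (hw₂ : ∀ x, w x * star (w x) = rep (fiber α x) (rankOneK e e))
    (hw₃ : ∀ x, w x * rep (fiber β x) (rankOneK e e) = w x) : FieldEquivalent α β := by
  obtain ⟨I, b, -⟩ := exists_hilbertBasis ℂ H
  choose u hu hint hbound using fun x => exists_unitary_intertwiner b
    (isNondegenerate_rep_fiber α x) (isNondegenerate_rep_fiber β x) he (hw₁ x) (hw₂ x) (hw₃ x)
  refine ⟨u, ⟨hu, fun ζ => ?_⟩, hint⟩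
  refine continuous_iff_continuousAt.2 fun x₀ => ?_
  -- near `x₀`, the partial sum over a suitable `s` is uniformly close to `u`
  refine continuousAt_of_locally_uniform_approx_of_continuousAt fun V hV => ?_
  obtain ⟨ε, hε, hεV⟩ := Metric.mem_uniformity_dist.1 hV
  have hz : 0 < ‖ζ‖ + 1 := by positivity
  have hδ : 0 < ε ^ 2 / (‖ζ‖ + 1) := by positivity
  obtain ⟨s, hs⟩ := ((Metric.tendsto_nhds.1
    ((isNondegenerate_rep_fiber β x₀).tendsto_basisProj b ζ)) _ hδ).exists
  have hcont : Continuous fun x => rep (fiber β x) (basisProj b s) ζ :=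
    (continuous_rep_fiber β _).clm_apply continuous_const
  refine ⟨_, (Metric.tendsto_nhds.1 (hcont.tendsto x₀) _ (sub_pos.2 hs)),
    fun x => partialIntertwiner b (rep (fiber α x)) (rep (fiber β x)) e (w x) s ζ, ?_, ?_⟩
  · refine Continuous.continuousAt ?_
    refine Continuous.clm_apply ?_ continuous_const
    exact continuous_finsetSum _ fun i _ =>
      ((continuous_rep_fiber α _).mul hw).mul (continuous_rep_fiber β _)
  · intro x hx
    refine hεV ?_
    rw [dist_eq_norm]
    refine lt_of_pow_lt_pow_left₀ 2 hε.le ((hbound x s ζ).trans_lt ?_)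
    have h1 : ‖ζ - rep (fiber β x) (basisProj b s) ζ‖ < ε ^ 2 / (‖ζ‖ + 1) := by
      rw [norm_sub_rev, ← dist_eq_norm]
      have := dist_triangle (rep (fiber β x) (basisProj b s) ζ)
        (rep (fiber β x₀) (basisProj b s) ζ) ζ
      have hx' : dist (rep (fiber β x) (basisProj b s) ζ) (rep (fiber β x₀) (basisProj b s) ζ)
        < ε ^ 2 / (‖ζ‖ + 1) - dist (rep (fiber β x₀) (basisProj b s) ζ) ζ := hx
      linarith
    calc _ ≤ ‖ζ - rep (fiber β x) (basisProj b s) ζ‖ * (‖ζ‖ + 1) := by gcongr; linarith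
      _ < ε ^ 2 / (‖ζ‖ + 1) * (‖ζ‖ + 1) := by gcongr
      _ = ε ^ 2 := by field_simp

/-- It suffices to have a continuous family of invertible maps between the ranges of `β_x(p)` and
`α_x(p)`, `p` a rank one projection: their polar parts are unitary. -/
theorem fieldEquivalent_of_invertible {α β : C0End X H} {e : H} (he : ‖e‖ = 1)
    {L M : X → H →L[ℂ] H} (hL : Continuous L) (hM : Continuous M)
    (hLP : ∀ x, L x * rep (fiber β x) (rankOneK e e) = L x)
    (hPM : ∀ x, rep (fiber β x) (rankOneK e e) * M x = M x)
    (hML : ∀ x, M x * L x = rep (fiber β x) (rankOneK e e))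
    (hLM : ∀ x, L x * M x = rep (fiber α x) (rankOneK e e)) : FieldEquivalent α β := by
  have hstar (φ : 𝒦 H →⋆ₙₐ[ℂ] 𝒦 H) : star (rep φ (rankOneK e e)) = rep φ (rankOneK e e) := by
    rw [← map_star, star_rankOneK]
  have hmul (φ : 𝒦 H →⋆ₙₐ[ℂ] 𝒦 H) :
      rep φ (rankOneK e e) * rep φ (rankOneK e e) = rep φ (rankOneK e e) := by
    rw [← map_mul, rankOneK_mul_self he]
  have key (x : X) := polar_part (hstar (fiber β x)) (hmul _) (hstar (fiber α x)) (hmul _)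
    (hLP x) (hPM x) (hML x) (hLM x)
  refine fieldEquivalent_of_partialIsometry he (w := fun x => L x *
    CFC.sqrt (M x * star (M x) + (1 - rep (fiber β x) (rankOneK e e)))) ?_
    (fun x => (key x).2.1) (fun x => (key x).2.2.1) (fun x => (key x).2.2.2)
  refine hL.mul (CFC.continuousOn_sqrt.comp_continuous ?_ fun x => (key x).1)
  exact (hM.mul hM.star).add (continuous_const.sub (continuous_rep_fiber β _))

end Field

/-! ### Unitary fields and unitary multipliers -/

section Multiplier

variable {X : Type*} [TopologicalSpace X]
  {H : Type*} [NormedAddCommGroup H] [InnerProductSpace ℂ H] [CompleteSpace H]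

theorem tendsto_zero_of_norm_le {f : C0K X H} {g : X → 𝒦 H} (h : ∀ x, ‖g x‖ ≤ ‖f x‖) :
    Tendsto g (cocompact X) (𝓝 0) := by
  have hf := (zero_at_infty f).norm
  rw [norm_zero] at hf
  exact squeeze_zero_norm h hf

theorem C0K.norm_le_of_forall {f : C0K X H} {C : ℝ} (hC : 0 ≤ C) (h : ∀ x, ‖f x‖ ≤ C) :
    ‖f‖ ≤ C := by
  rw [← ZeroAtInftyContinuousMap.norm_toBCF_eq_norm, BoundedContinuousFunction.norm_le hC]
  exact h

namespace IsUnitaryField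

variable {u : X → H →L[ℂ] H} (hu : IsUnitaryField u)

/-- The product `u f` of a strongly continuous family of unitaries with `f ∈ C₀(X) ⊗ K`. -/
def mulLeft (f : C0K X H) : C0K X H where
  toFun x := ⟨u x * (f x).1, (f x).2.clm_comp (u x)⟩
  continuous_toFun := continuous_induced_rng.2 (hu.continuous_mul (map_continuous f))
  zero_at_infty' := tendsto_zero_of_norm_le (f := f) fun x =>
    (norm_mul_le _ _).trans (mul_le_of_le_one_left (norm_nonneg _) (hu.norm_le x))

/-- The product `f u` of `f ∈ C₀(X) ⊗ K` with a strongly continuous family of unitaries. -/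
def mulRight (f : C0K X H) : C0K X H where
  toFun x := ⟨(f x).1 * u x, (f x).2.comp_clm (u x)⟩
  continuous_toFun := continuous_induced_rng.2 (hu.continuous_mul_right (map_continuous f))
  zero_at_infty' := tendsto_zero_of_norm_le (f := f) fun x =>
    (norm_mul_le _ _).trans (mul_le_of_le_one_right (norm_nonneg _) (hu.norm_le x))

/-- The multiplier of `C₀(X) ⊗ K` given by a strongly continuous family of unitaries. -/
def multiplier : DoubleCentralizer ℂ (C0K X H) where
  fst := LinearMap.mkContinuous
    { toFun := hu.mulLeft
      map_add' := fun f g => DFunLike.ext _ _ fun x => Subtype.ext (mul_add _ _ _)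
      map_smul' := fun c f => DFunLike.ext _ _ fun x => Subtype.ext (mul_smul_comm _ _ _) } 1
    fun f => by
      rw [one_mul]
      exact C0K.norm_le_of_forall (norm_nonneg _) fun x =>
        ((norm_mul_le _ _).trans (mul_le_of_le_one_left (norm_nonneg _) (hu.norm_le x))).trans
          (norm_apply_le f x)
  snd := LinearMap.mkContinuous
    { toFun := hu.mulRight
      map_add' := fun f g => DFunLike.ext _ _ fun x => Subtype.ext (add_mul _ _ _)
      map_smul' := fun c f => DFunLike.ext _ _ fun x => Subtype.ext (smul_mul_assoc _ _ _) } 1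
    fun f => by
      rw [one_mul]
      exact C0K.norm_le_of_forall (norm_nonneg _) fun x =>
        ((norm_mul_le _ _).trans (mul_le_of_le_one_right (norm_nonneg _) (hu.norm_le x))).trans
          (norm_apply_le f x)
  central f g := DFunLike.ext _ _ fun x => Subtype.ext (mul_assoc _ _ _)

theorem multiplier_fst (f : C0K X H) (x : X) : (hu.multiplier.fst f x).1 = u x * (f x).1 := rfl

theorem multiplier_snd (f : C0K X H) (x : X) : (hu.multiplier.snd f x).1 = (f x).1 * u x := rfl

theorem star_multiplier_fst (f : C0K X H) (x : X) :
    ((star hu.multiplier).fst f x).1 = star (u x) * (f x).1 := by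
  rw [DoubleCentralizer.star_fst]
  change star ((f x : 𝒦 H).1.adjoint * u x) = _
  rw [star_mul]
  congr 1
  exact star_star (f x).1

theorem star_multiplier_snd (f : C0K X H) (x : X) :
    ((star hu.multiplier).snd f x).1 = (f x).1 * star (u x) := by
  rw [DoubleCentralizer.star_snd]
  change star (u x * (f x : 𝒦 H).1.adjoint) = _
  rw [star_mul]
  congr 1
  exact star_star (f x).1

theorem multiplier_ext {a b : DoubleCentralizer ℂ (C0K X H)}
    (h₁ : ∀ f x, (a.fst f x).1 = (b.fst f x).1) (h₂ : ∀ f x, (a.snd f x).1 = (b.snd f x).1) :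
    a = b :=
  DoubleCentralizer.ext _ _ _ _ (Prod.ext
    (ContinuousLinearMap.ext fun f => DFunLike.ext _ _ fun x => Subtype.ext (h₁ f x))
    (ContinuousLinearMap.ext fun f => DFunLike.ext _ _ fun x => Subtype.ext (h₂ f x)))

theorem multiplier_mem_unitary : hu.multiplier ∈ unitary (DoubleCentralizer ℂ (C0K X H)) := by
  constructor
  · refine multiplier_ext (fun f x => ?_) (fun f x => ?_)
    · rw [DoubleCentralizer.mul_fst, mul_apply_eq_comp, hu.star_multiplier_fst,
        hu.multiplier_fst, ← mul_assoc, hu.star_mul_self, one_mul]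
      rfl
    · rw [DoubleCentralizer.mul_snd, mul_apply_eq_comp,
        hu.multiplier_snd, hu.star_multiplier_snd, mul_assoc, hu.star_mul_self, mul_one]
      rfl
  · refine multiplier_ext (fun f x => ?_) (fun f x => ?_)
    · rw [DoubleCentralizer.mul_fst, mul_apply_eq_comp,
        hu.multiplier_fst, hu.star_multiplier_fst, ← mul_assoc, hu.mul_star_self, one_mul]
      rfl
    · rw [DoubleCentralizer.mul_snd, mul_apply_eq_comp,
        hu.star_multiplier_snd, hu.multiplier_snd, mul_assoc, hu.mul_star_self, mul_one]
      rfl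

end IsUnitaryField

variable [LocallyCompactSpace X] [T2Space X]

theorem FieldEquivalent.innerEquivalent {α β : C0End X H} (h : FieldEquivalent α β) :
    InnerEquivalent α β := by
  obtain ⟨u, hu, hint⟩ := h
  have hα (f : C0K X H) (x : X) : (α f x).1 = u x * (β f x).1 * star (u x) := by
    rw [apply_eq_fiber, apply_eq_fiber]
    change rep (fiber α x) (f x) = u x * rep (fiber β x) (f x) * star (u x)
    rw [hint, mul_assoc, hu.mul_star_self, mul_one]
  refine ⟨hu.multiplier, hu.multiplier_mem_unitary, fun f => ?_⟩
  refine IsUnitaryField.multiplier_ext (fun g x => ?_) (fun g x => ?_)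
  · rw [DoubleCentralizer.mul_fst, DoubleCentralizer.mul_fst]
    change (α f x).1 * (g x).1 = u x * ((β f x).1 * ((star hu.multiplier).fst g x).1)
    rw [hu.star_multiplier_fst, hα]
    simp only [mul_assoc]
  · rw [DoubleCentralizer.mul_snd, DoubleCentralizer.mul_snd]
    change (g x).1 * (α f x).1 = ((star hu.multiplier).snd ((hu.mulRight g) * β f) x).1
    rw [hu.star_multiplier_snd, hα]
    change _ = ((g x).1 * u x) * (β f x).1 * star (u x)
    simp only [mul_assoc]

/-- The left action of a multiplier commutes with right multiplication. -/
theorem multiplier_fst_mul {A : Type*} [NonUnitalCStarAlgebra A]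
    (U : DoubleCentralizer ℂ A) (a b : A) : U.fst (a * b) = U.fst a * b := by
  have h (z : A) : z * (U.fst (a * b) - U.fst a * b) = 0 := by
    rw [mul_sub, ← U.central, ← mul_assoc z, ← U.central, mul_assoc, sub_self]
  exact sub_eq_zero.1 (CStarRing.star_mul_self_eq_zero_iff _ |>.1 (h _))

omit [LocallyCompactSpace X] [T2Space X] in
/-- The value of `U f` at `x` only depends on `f x`: if `f x = 0`, then `(U f)* (U f)`, being a
right multiple of `f`, vanishes at `x`. -/
theorem fst_apply_eq_zero (U : DoubleCentralizer ℂ (C0K X H)) {f : C0K X H} {x : X}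
    (hf : f x = 0) : U.fst f x = 0 := by
  have h : (star (U.fst f) * U.fst f) x = 0 := by
    rw [← U.central, ZeroAtInftyContinuousMap.mul_apply, hf, mul_zero]
  rw [ZeroAtInftyContinuousMap.mul_apply, ZeroAtInftyContinuousMap.star_apply] at h
  exact CStarRing.star_mul_self_eq_zero_iff _ |>.1 h

omit [LocallyCompactSpace X] [T2Space X] in
theorem fst_apply_congr (U : DoubleCentralizer ℂ (C0K X H)) {f g : C0K X H} {x : X}
    (h : f x = g x) : U.fst f x = U.fst g x := by
  have h1 := fst_apply_eq_zero U (f := f - g) (x := x) (by simp [h])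
  rw [map_sub] at h1
  exact sub_eq_zero.1 h1

/-- The linear map on `H` induced on the fiber over `x` by a multiplier `U`; it is
`ξ ↦ U(ξ ⊗ e*)(x) e` for any unit vector `e`. -/
def multiplierFiber (U : DoubleCentralizer ℂ (C0K X H)) (e : H) (x : X) : H →ₗ[ℂ] H where
  toFun ξ := (U.fst (lift x (rankOneK ξ e)) x).1 e
  map_add' ξ η := by
    have h : U.fst (lift x (rankOneK (ξ + η) e)) x
        = U.fst (lift x (rankOneK ξ e) + lift x (rankOneK η e)) x :=
      fst_apply_congr U (by simp [lift_apply, rankOneK_add_left])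
    rw [h, map_add]
    rfl
  map_smul' c ξ := by
    have h : U.fst (lift x (rankOneK (c • ξ) e)) x = U.fst (c • lift x (rankOneK ξ e)) x :=
      fst_apply_congr U (by simp [lift_apply, rankOneK_smul_left])
    rw [h, map_smul]
    rfl

variable {e : H}

/-- The left action of a multiplier is pointwise composition with the induced maps on the fibers. -/
theorem fst_apply_apply (he : ‖e‖ = 1) (U : DoubleCentralizer ℂ (C0K X H)) (f : C0K X H) (x : X)
    (ζ : H) : (U.fst f x).1 ζ = multiplierFiber U e x ((f x).1 ζ) := by
  let _ : NonUnitalCStarAlgebra (C0K X H) := { }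
  have h : U.fst (lift x (rankOneK ((f x).1 ζ) e)) x = U.fst (f * lift x (rankOneK ζ e)) x :=
    fst_apply_congr U (by
      rw [ZeroAtInftyContinuousMap.mul_apply, lift_apply, lift_apply, mul_rankOneK])
  change _ = (U.fst (lift x (rankOneK ((f x).1 ζ) e)) x).1 e
  rw [h, multiplier_fst_mul]
  change _ = (U.fst f x * lift x (rankOneK ζ e) x : 𝒦 H).1 e
  rw [lift_apply, mul_rankOneK, rankOneK_apply, inner_self_eq_norm_sq_to_K, he]
  simp

theorem multiplierFiber_mul (he : ‖e‖ = 1) (U V : DoubleCentralizer ℂ (C0K X H)) (x : X) (ξ : H) :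
    multiplierFiber (U * V) e x ξ = multiplierFiber U e x (multiplierFiber V e x ξ) := by
  change ((U * V).fst _ x).1 e = _
  rw [DoubleCentralizer.mul_fst]
  exact fst_apply_apply he U _ x e

theorem multiplierFiber_one (he : ‖e‖ = 1) (x : X) (ξ : H) :
    multiplierFiber (1 : DoubleCentralizer ℂ (C0K X H)) e x ξ = ξ := by
  change (lift x (rankOneK ξ e) x).1 e = ξ
  rw [lift_apply, rankOneK_apply, inner_self_eq_norm_sq_to_K, he]
  simp

theorem inner_multiplierFiber (he : ‖e‖ = 1) (U : DoubleCentralizer ℂ (C0K X H)) (x : X)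
    (ξ η : H) :
    ⟪multiplierFiber U e x ξ, η⟫_ℂ = ⟪ξ, multiplierFiber (star U) e x η⟫_ℂ := by
  have h : star (U.fst (lift x (rankOneK ξ e))) * lift x (rankOneK η e)
      = star (lift x (rankOneK ξ e)) * (star U).fst (lift x (rankOneK η e)) := by
    rw [← (star U).central, DoubleCentralizer.star_snd, star_star]
  have h1 := congr((($h : C0K X H) x).1 e)
  have h2 := congr(⟪e, $h1⟫_ℂ)
  change ⟪e, star (U.fst (lift x (rankOneK ξ e)) x).1 ((lift x (rankOneK η e) x).1 e)⟫_ℂ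
    = ⟪e, star (lift x (rankOneK ξ e) x).1 (((star U).fst (lift x (rankOneK η e)) x).1 e)⟫_ℂ at h2
  rw [ContinuousLinearMap.star_eq_adjoint, ContinuousLinearMap.star_eq_adjoint,
    ContinuousLinearMap.adjoint_inner_right, ContinuousLinearMap.adjoint_inner_right,
    lift_apply, lift_apply, rankOneK_apply, rankOneK_apply, inner_self_eq_norm_sq_to_K, he] at h2
  simp only [RCLike.ofReal_one, one_pow, one_smul] at h2
  exact h2

theorem norm_multiplierFiber (he : ‖e‖ = 1) {U : DoubleCentralizer ℂ (C0K X H)}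
    (hU : star U * U = 1) (x : X) (ξ : H) : ‖multiplierFiber U e x ξ‖ = ‖ξ‖ := by
  have h := inner_multiplierFiber he U x ξ (multiplierFiber U e x ξ)
  rw [← multiplierFiber_mul he, hU, multiplierFiber_one he, inner_self_eq_norm_sq_to_K,
    inner_self_eq_norm_sq_to_K] at h
  exact (sq_eq_sq₀ (norm_nonneg _) (norm_nonneg _)).1 (by exact_mod_cast h)

theorem continuous_multiplierFiber (U : DoubleCentralizer ℂ (C0K X H)) (ξ : H) :
    Continuous fun x => multiplierFiber U e x ξ := by
  rw [continuous_iff_continuousAt]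
  intro x
  obtain ⟨f, hf⟩ := exists_eventually_eq x (rankOneK ξ e)
  have h1 : Continuous fun y => (U.fst f y).1 e :=
    (𝒦.continuous_coe.comp (map_continuous (U.fst f))).clm_apply continuous_const
  refine h1.continuousAt.congr ?_
  filter_upwards [hf] with y hy
  exact congr(($(fst_apply_congr U (hy.trans (lift_apply y _).symm))).1 e)

theorem InnerEquivalent.fieldEquivalent {α β : C0End X H} (h : InnerEquivalent α β) :
    FieldEquivalent α β := by
  obtain ⟨U, hU, hαβ⟩ := h
  cases subsingleton_or_nontrivial H with
  | inl hH => exact fieldEquivalent_of_subsingleton α β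
  | inr hH =>
    obtain ⟨e, he⟩ := exists_norm_eq H zero_le_one
    let u (x : X) : H →L[ℂ] H := (multiplierFiber U e x).mkContinuous 1
      fun ξ => by rw [norm_multiplierFiber he hU.1, one_mul]
    let v (x : X) : H →L[ℂ] H := (multiplierFiber (star U) e x).mkContinuous 1
      fun ξ => by rw [norm_multiplierFiber he (by simpa using hU.2), one_mul]
    have hstar (x : X) : star (u x) = v x := by
      rw [ContinuousLinearMap.star_eq_adjoint, eq_comm, ContinuousLinearMap.eq_adjoint_iff]
      intro ξ η
      have := inner_multiplierFiber he (star U) x ξ η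
      rwa [star_star] at this
    refine ⟨u, ⟨fun x => ⟨?_, ?_⟩, continuous_multiplierFiber U⟩, fun x A => ?_⟩
    · rw [hstar]
      ext ξ
      change multiplierFiber (star U) e x (multiplierFiber U e x ξ) = ξ
      rw [← multiplierFiber_mul he, hU.1, multiplierFiber_one he]
    · rw [hstar]
      ext ξ
      change multiplierFiber U e x (multiplierFiber (star U) e x ξ) = ξ
      rw [← multiplierFiber_mul he, hU.2, multiplierFiber_one he]
    · have h1 : DoubleCentralizer.coe ℂ (α (lift x A)) * U
          = U * DoubleCentralizer.coe ℂ (β (lift x A)) := by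
        rw [hαβ, mul_assoc, hU.1, mul_one]
      ext ζ
      have h2 := fst_apply_apply he (DoubleCentralizer.coe ℂ (α (lift x A)) * U)
        (lift x (rankOneK ζ e)) x e
      have h3 := congr(((($h1).fst (lift x (rankOneK ζ e))) x).1 e)
      rw [DoubleCentralizer.mul_fst, DoubleCentralizer.mul_fst] at h3
      change (α (lift x A) x * U.fst (lift x (rankOneK ζ e)) x : 𝒦 H).1 e
        = (U.fst (β (lift x A) * lift x (rankOneK ζ e)) x).1 e at h3
      rw [fst_apply_apply he U (β (lift x A) * lift x (rankOneK ζ e)),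
        ZeroAtInftyContinuousMap.mul_apply, lift_apply, mul_rankOneK, rankOneK_apply,
        inner_self_eq_norm_sq_to_K, he] at h3
      simp only [RCLike.ofReal_one, one_pow, one_smul] at h3
      exact h3.symm

end Multiplier

/-! ### Isomorphisms of the bundles of intertwiners -/

section Bundle

variable {H : Type*} [NormedAddCommGroup H] [InnerProductSpace ℂ H] [CompleteSpace H]

theorem mem_intertwiners {φ : 𝒦 H →⋆ₙₐ[ℂ] 𝒦 H} {T : H →Lₚₜ[ℂ] H} :
    T ∈ intertwiners φ ↔ ∀ (A : 𝒦 H) (ξ : H), T (A.1 ξ) = rep φ A (T ξ) := Iff.rfl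

/-- A unitary `v` that conjugates `φ` to `ψ` identifies the intertwiners of `φ` with those of
`ψ`. -/
def intertwinersEquiv {φ ψ : 𝒦 H →⋆ₙₐ[ℂ] 𝒦 H} (v : H →L[ℂ] H) (hv : v ∈ unitary (H →L[ℂ] H))
    (h : ∀ A, v * rep φ A = rep ψ A * v) : intertwiners φ ≃ₗ[ℂ] intertwiners ψ where
  toFun T := ⟨PointwiseConvergenceCLM.postcomp H v T.1, fun A ξ => by
    change v (T.1 (A.1 ξ)) = rep ψ A (v (T.1 ξ))
    rw [mem_intertwiners.1 T.2]
    exact congr($(h A) (T.1 ξ))⟩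
  invFun T := ⟨PointwiseConvergenceCLM.postcomp H (star v) T.1, fun A ξ => by
    change star v (T.1 (A.1 ξ)) = rep φ A (star v (T.1 ξ))
    rw [mem_intertwiners.1 T.2]
    have h1 : star v * rep ψ A = rep φ A * star v := by
      calc star v * rep ψ A = star v * (rep ψ A * v) * star v := by
            rw [mul_assoc, mul_assoc, hv.2, mul_one]
        _ = rep φ A * star v := by rw [← h, ← mul_assoc, hv.1, one_mul]
    exact congr($h1 (T.1 ξ))⟩
  map_add' S T := by ext1; exact map_add _ _ _
  map_smul' c T := by ext1; exact map_smul (PointwiseConvergenceCLM.postcomp H v) c T.1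
  left_inv T := by
    ext ξ
    exact congr($(hv.1) (T.1 ξ))
  right_inv T := by
    ext ξ
    exact congr($(hv.2) (T.1 ξ))

/-- The intertwiner `ξ ↦ φ(ξ ⊗ e*) η`. For a unit vector `e`, these are all intertwiners, and `η`
can be taken in the range of `φ(e ⊗ e*)`. -/
def toIntertwiner (φ : 𝒦 H →⋆ₙₐ[ℂ] 𝒦 H) (e : H) : H →ₗ[ℂ] intertwiners φ where
  toFun η := ⟨LinearMap.mkContinuous
      { toFun := fun ξ => rep φ (rankOneK ξ e) η
        map_add' := fun a c => by simp [rankOneK_add_left]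
        map_smul' := fun z a => by simp [rankOneK_smul_left] } (‖e‖ * ‖η‖) fun ξ => by
      refine ((rep φ (rankOneK ξ e)).le_of_opNorm_le
        ((norm_rep_le _ _).trans (norm_rankOneK ξ e).le) η).trans_eq ?_
      ring, fun A ξ => by
      change rep φ (rankOneK (A.1 ξ) e) η = rep φ A (rep φ (rankOneK ξ e) η)
      rw [← mul_rankOneK, map_mul]
      rfl⟩
  map_add' a c := by ext ξ; exact map_add (rep φ (rankOneK ξ e)) a c
  map_smul' z a := by ext ξ; exact map_smul (rep φ (rankOneK ξ e)) z a

theorem toIntertwiner_apply (φ : 𝒦 H →⋆ₙₐ[ℂ] 𝒦 H) (e η ξ : H) :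
    (toIntertwiner φ e η).1 ξ = rep φ (rankOneK ξ e) η := rfl

variable {φ ψ : 𝒦 H →⋆ₙₐ[ℂ] 𝒦 H} {e : H}

theorem rep_apply_intertwiner (he : ‖e‖ = 1) (S : intertwiners φ) (ξ : H) :
    rep φ (rankOneK ξ e) (S.1 e) = S.1 ξ := by
  rw [← mem_intertwiners.1 S.2, rankOneK_apply, inner_self_eq_norm_sq_to_K, he]
  simp

theorem toIntertwiner_apply_self (he : ‖e‖ = 1) (S : intertwiners φ) :
    toIntertwiner φ e (S.1 e) = S := by
  ext ξ
  exact rep_apply_intertwiner he S ξ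

theorem toIntertwiner_rep (he : ‖e‖ = 1) (η : H) :
    toIntertwiner φ e (rep φ (rankOneK e e) η) = toIntertwiner φ e η := by
  ext ξ
  rw [toIntertwiner_apply, toIntertwiner_apply, ← mul_apply_eq_comp, ← map_mul,
    rankOneK_mul_self he]

/-- A linear map between spaces of intertwiners of `φ` and `ψ`, viewed as an operator on `H` that
is supported on the range of `φ(e ⊗ e*)`. It is continuous because this range has finite
dimension. -/
def intertwinerMap (he : ‖e‖ = 1) (J : intertwiners φ →ₗ[ℂ] intertwiners ψ) : H →L[ℂ] H :=
  let F := Module.End.eigenspace ((rep φ (rankOneK e e) : H →L[ℂ] H) : H →ₗ[ℂ] H) 1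
  have : FiniteDimensional ℂ F :=
    ContinuousLinearMap.finite_dimensional_eigenspace (φ (rankOneK e e)).2 1 one_ne_zero
  let j : F →ₗ[ℂ] H :=
    { toFun := fun η => (J (toIntertwiner φ e η.1)).1 e
      map_add' := fun a c => by simp
      map_smul' := fun z a => by simp }
  (LinearMap.toContinuousLinearMap j).comp ((rep φ (rankOneK e e)).codRestrict F fun η => by
    rw [Module.End.mem_eigenspace_iff, one_smul]
    change (rep φ (rankOneK e e) * rep φ (rankOneK e e)) η = _
    rw [← map_mul, rankOneK_mul_self he])

theorem intertwinerMap_apply (he : ‖e‖ = 1) (J : intertwiners φ →ₗ[ℂ] intertwiners ψ) (η : H) :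
    intertwinerMap he J η = (J (toIntertwiner φ e η)).1 e := by
  rw [← toIntertwiner_rep he]
  rfl

theorem intertwinerMap_mul_rep (he : ‖e‖ = 1) (J : intertwiners φ →ₗ[ℂ] intertwiners ψ) :
    intertwinerMap he J * rep φ (rankOneK e e) = intertwinerMap he J := by
  ext η
  rw [mul_apply_eq_comp, intertwinerMap_apply, intertwinerMap_apply, toIntertwiner_rep he]

theorem rep_mul_intertwinerMap (he : ‖e‖ = 1) (J : intertwiners φ →ₗ[ℂ] intertwiners ψ) :
    rep ψ (rankOneK e e) * intertwinerMap he J = intertwinerMap he J := by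
  ext η
  rw [mul_apply_eq_comp, intertwinerMap_apply, rep_apply_intertwiner he]

theorem intertwinerMap_mul_intertwinerMap (he : ‖e‖ = 1)
    (J : intertwiners φ →ₗ[ℂ] intertwiners ψ) (J' : intertwiners ψ →ₗ[ℂ] intertwiners φ)
    (h : ∀ S, J' (J S) = S) :
    intertwinerMap he J' * intertwinerMap he J = rep φ (rankOneK e e) := by
  ext η
  rw [mul_apply_eq_comp, intertwinerMap_apply, intertwinerMap_apply, toIntertwiner_apply_self he,
    h, toIntertwiner_apply]

/-- A strongly continuous family of operators `D x`, supported on the ranges of a norm continuous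
family `P x` of projections of finite rank, is norm continuous. -/
theorem continuous_of_mul_projection {X : Type*} [TopologicalSpace X] {D P : X → H →L[ℂ] H}
    (hD : ∀ η, Continuous fun x => D x η) (hP : Continuous P) (hPP : ∀ x, P x * P x = P x)
    (hPc : ∀ x, IsCompactOperator (P x)) (hDP : ∀ x, D x * P x = D x) : Continuous D := by
  rw [continuous_iff_continuousAt]
  intro x₀
  let F := Module.End.eigenspace ((P x₀ : H →L[ℂ] H) : H →ₗ[ℂ] H) 1
  have : FiniteDimensional ℂ F :=
    ContinuousLinearMap.finite_dimensional_eigenspace (hPc x₀) 1 one_ne_zero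
  let q : H →L[ℂ] F := (P x₀).codRestrict F fun η => by
    rw [Module.End.mem_eigenspace_iff, one_smul]
    exact congr($(hPP x₀) η)
  have h1 : Continuous fun x => (D x).comp F.subtypeL :=
    continuous_clm_apply.2 fun η => hD η.1
  have h2 : Continuous fun x => D x * P x₀ := h1.clm_comp (continuous_const (y := q))
  -- near `x₀`, the part of `D x` that `P x₀` does not see has at most half the norm of `D x`
  have hbdd : ∀ᶠ x in 𝓝 x₀, ‖D x‖ ≤ 2 * (‖D x₀ * P x₀‖ + 1) := by
    have h3 := (tendsto_iff_norm_sub_tendsto_zero.1 (hP.tendsto x₀)).eventually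
      (gt_mem_nhds (show (0 : ℝ) < 1 / 2 by norm_num))
    have h4 := (h2.norm.tendsto x₀).eventually (gt_mem_nhds (lt_add_one ‖D x₀ * P x₀‖))
    filter_upwards [h3, h4] with x hx1 hx2
    have e1 : D x = D x * P x₀ + D x * (P x - P x₀) := by rw [mul_sub, hDP]; abel
    have h5 : ‖D x‖ ≤ ‖D x * P x₀‖ + ‖D x‖ * ‖P x - P x₀‖ := by
      conv_lhs => rw [e1]
      exact (norm_add_le _ _).trans (by gcongr; exact norm_mul_le _ _)
    nlinarith [norm_nonneg (D x)]
  have h6 := tendsto_mul_of_isCompactOperator hbdd (fun ξ => (hD ξ).tendsto x₀)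
    (hP.tendsto x₀) (hPc x₀)
  simp only [hDP] at h6
  exact h6

variable {X : Type*} [TopologicalSpace X] [LocallyCompactSpace X] [T2Space X]

theorem continuous_intertwinerMap {α β : C0End X H} (he : ‖e‖ = 1)
    (J : ∀ x, intertwiners (fiber α x) →ₗ[ℂ] intertwiners (fiber β x))
    (hJ : Continuous fun p : vect α =>
      (⟨(p.1.1, (J p.1.1 ⟨p.1.2, p.2⟩).1), (J p.1.1 ⟨p.1.2, p.2⟩).2⟩ : vect β)) :
    Continuous fun x => intertwinerMap he (J x) := by
  refine continuous_of_mul_projection (P := fun x => rep (fiber α x) (rankOneK e e)) (fun η => ?_)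
    (continuous_rep_fiber α _) (fun x => ?_) (fun x => (fiber α x (rankOneK e e)).2)
    (fun x => intertwinerMap_mul_rep he (J x))
  · have h1 : Continuous fun x => (⟨(x, (toIntertwiner (fiber α x) e η).1),
        (toIntertwiner (fiber α x) e η).2⟩ : vect α) := by
      refine Continuous.subtype_mk (continuous_id.prodMk ?_) _
      exact PointwiseConvergenceCLM.continuous_of_continuous_eval fun ξ =>
        (continuous_rep_fiber α (rankOneK ξ e)).clm_apply continuous_const
    have h2 := (continuous_snd.comp (continuous_subtype_val.comp (hJ.comp h1)))
    have h3 := (PointwiseConvergenceCLM.evalCLM (RingHom.id ℂ) H e).continuous.comp h2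
    refine h3.congr fun x => ?_
    rw [intertwinerMap_apply]
    rfl
  · rw [← map_mul, rankOneK_mul_self he]

theorem VectIso.fieldEquivalent {α β : C0End X H} (i : VectIso α β) : FieldEquivalent α β := by
  cases subsingleton_or_nontrivial H with
  | inl hH => exact fieldEquivalent_of_subsingleton α β
  | inr hH =>
    obtain ⟨e, he⟩ := exists_norm_eq H zero_le_one
    have hM : Continuous fun x => intertwinerMap he (i.fiberIso x).toLinearMap :=
      continuous_intertwinerMap he (fun x => (i.fiberIso x).toLinearMap) i.continuous_toFun
    have hL : Continuous fun x => intertwinerMap he (i.fiberIso x).symm.toLinearMap :=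
      continuous_intertwinerMap he (fun x => (i.fiberIso x).symm.toLinearMap) i.continuous_invFun
    exact fieldEquivalent_of_invertible he hL hM (fun x => intertwinerMap_mul_rep he _)
      (fun x => rep_mul_intertwinerMap he _)
      (fun x => intertwinerMap_mul_intertwinerMap he _ _ (i.fiberIso x).apply_symm_apply)
      (fun x => intertwinerMap_mul_intertwinerMap he _ _ (i.fiberIso x).symm_apply_apply)

/-- Left multiplication with a strongly continuous family of unitaries is continuous on
`vect(α)`. -/
theorem IsUnitaryField.continuous_postcomp {α β : C0End X H} {u : X → H →L[ℂ] H}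
    (hu : IsUnitaryField u) {f : vect α → vect β}
    (hf : ∀ p, (f p).1 = (p.1.1, PointwiseConvergenceCLM.postcomp H (u p.1.1) p.1.2)) :
    Continuous f := by
  refine continuous_induced_rng.2 ?_
  change Continuous fun p => (f p).1
  simp only [hf]
  refine (continuous_fst.comp continuous_subtype_val).prodMk ?_
  refine PointwiseConvergenceCLM.continuous_of_continuous_eval fun ξ => ?_
  exact hu.continuous_apply₂ (continuous_fst.comp continuous_subtype_val)
    ((PointwiseConvergenceCLM.evalCLM (RingHom.id ℂ) H ξ).continuous.comp
      (continuous_snd.comp continuous_subtype_val))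

theorem FieldEquivalent.exists_hermitian_vectIso {α β : C0End X H} (h : FieldEquivalent α β) :
    ∃ i : VectIso α β, i.IsHermitian := by
  obtain ⟨u, hu, hint⟩ := h
  have h1 (x : X) (A : 𝒦 H) :
      star (u x) * rep (fiber α x) A = rep (fiber β x) A * star (u x) := by
    calc star (u x) * rep (fiber α x) A
        = star (u x) * (rep (fiber α x) A * u x) * star (u x) := by
          rw [mul_assoc, mul_assoc, hu.mul_star_self, mul_one]
      _ = rep (fiber β x) A * star (u x) := by
          rw [← hint, ← mul_assoc, hu.star_mul_self, one_mul]
  refine ⟨⟨fun x => intertwinersEquiv (star (u x)) (hu.star.mem_unitary x) (h1 x),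
    hu.star.continuous_postcomp fun p => rfl,
    hu.star.star.continuous_postcomp fun p => rfl⟩, fun x S T ξ η => ?_⟩
  change ⟪star (u x) (T.1 η), star (u x) (S.1 ξ)⟫_ℂ = _
  conv_lhs => rw [ContinuousLinearMap.star_eq_adjoint]
  rw [ContinuousLinearMap.adjoint_inner_left, ← ContinuousLinearMap.star_eq_adjoint,
    hu.apply_star_apply]

end Bundle

/-! ### Transport along a homotopy of projections -/

section Transport

/-- A modulus of uniform continuity for paths, depending continuously on the path. -/
theorem exists_continuous_modulus {E : Type*} [MetricSpace E] {ε : ℝ} (hε : 0 < ε) :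
    ∃ δ : C(C(unitInterval, E), ℝ), ∀ γ : C(unitInterval, E), 0 < δ γ ∧
      ∀ s t, dist s t ≤ δ γ → dist (γ s) (γ t) < ε := by
  refine exists_continuous_forall_mem_convex_of_local_const
    (t := fun γ : C(unitInterval, E) =>
      {d : ℝ | 0 < d ∧ ∀ s t, dist s t ≤ d → dist (γ s) (γ t) < ε}) (fun γ => ?_) fun γ => ?_
  · refine Set.OrdConnected.convex ⟨fun a ha c hc d hd => ⟨ha.1.trans_le hd.1, fun s t hst => ?_⟩⟩
    exact hc.2 s t (hst.trans hd.2)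
  · obtain ⟨d, hd, h⟩ := Metric.uniformContinuous_iff.1
      (CompactSpace.uniformContinuous_of_continuous γ.continuous) (ε / 3) (by positivity)
    refine ⟨d / 2, ?_⟩
    filter_upwards [Metric.ball_mem_nhds γ (show 0 < ε / 3 by positivity)] with γ' hγ'
    refine ⟨by positivity, fun s t hst => ?_⟩
    have h1 := h (a := s) (b := t) (by linarith)
    have h2 := (ContinuousMap.dist_apply_le_dist (f := γ') (g := γ) s).trans_lt hγ'
    have h3 := (ContinuousMap.dist_apply_le_dist (f := γ') (g := γ) t).trans_lt hγ'
    have h4 := dist_triangle4 (γ' s) (γ s) (γ t) (γ' t)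
    rw [dist_comm (γ t)] at h4
    linarith

variable {A : Type*} [NormedRing A]

/-- The element `q p + (1 - q) (1 - p)`, which carries the range of the idempotent `p` to that of
the idempotent `q`, and is invertible if `p` and `q` are close. -/
def stepTransport (p q : A) : A := q * p + (1 - q) * (1 - p)

theorem stepTransport_mul {p q : A} (hp : p * p = p) (hq : q * q = q) :
    stepTransport p q * p = q * stepTransport p q := by
  have h1 : (1 - p) * p = 0 := by rw [sub_mul, hp]; simp
  have h2 : q * (1 - q) = 0 := by rw [mul_sub, hq]; simp
  rw [stepTransport, add_mul, mul_add, mul_assoc, mul_assoc, h1, hp, ← mul_assoc q q, hq,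
    ← mul_assoc q, h2]
  simp

theorem stepTransport_self {p : A} (hp : p * p = p) : stepTransport p p = 1 := by
  have : (1 - p) * (1 - p) = 1 - p := by simp [mul_sub, sub_mul, hp]
  rw [stepTransport, hp, this]
  abel

theorem isUnit_stepTransport [CompleteSpace A] {p q : A} (hp : p * p = p) (hq : q * q = q)
    (hpn : ‖p‖ ≤ 1) (hqn : ‖q‖ ≤ 1) (h : ‖p - q‖ < 1 / 2) : IsUnit (stepTransport p q) := by
  have e : stepTransport p q = 1 - (q * (q - p) + (p - q) * p) := by
    simp only [stepTransport, mul_sub, sub_mul, hp, hq, mul_one, one_mul]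
    abel
  rw [e]
  refine isUnit_one_sub_of_norm_lt_one ?_
  have h1 : ‖q * (q - p)‖ ≤ ‖p - q‖ := by
    rw [norm_sub_rev p q]
    exact (norm_mul_le _ _).trans (mul_le_of_le_one_left (norm_nonneg _) hqn)
  have h2 : ‖(p - q) * p‖ ≤ ‖p - q‖ :=
    (norm_mul_le _ _).trans (mul_le_of_le_one_right (norm_nonneg _) hpn)
  linarith [norm_add_le (q * (q - p)) ((p - q) * p)]

variable {X : Type*} [TopologicalSpace X]

/-- The times at which the transport along a path is discretized: steps of length `d`, until time
`1` is reached. -/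
def stepTime (d : ℝ) (n : ℕ) : unitInterval := Set.projIcc 0 1 zero_le_one (n * d)

/-- The transport along the idempotents `P 0, P d, P (2 d), …` in `n` steps. -/
def transport (P : unitInterval → A) (d : ℝ) : ℕ → A
  | 0 => 1
  | n + 1 => stepTransport (P (stepTime d n)) (P (stepTime d (n + 1))) * transport P d n

theorem dist_stepTime_le {d : ℝ} (hd : 0 < d) (n : ℕ) :
    dist (stepTime d n) (stepTime d (n + 1)) ≤ d := by
  have h := Set.abs_projIcc_sub_projIcc (a := (0 : ℝ)) (b := 1) (c := n * d)
    (d := ((n + 1 : ℕ) : ℝ) * d) zero_le_one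
  have e : (n : ℝ) * d - ((n + 1 : ℕ) : ℝ) * d = -d := by push_cast; ring
  rw [e, abs_neg, abs_of_pos hd] at h
  exact h

theorem stepTime_eq_one {d : ℝ} {n : ℕ} (h : 1 ≤ n * d) : stepTime d n = 1 :=
  Set.projIcc_of_right_le _ h

theorem stepTime_zero (d : ℝ) : stepTime d 0 = 0 := by
  simp [stepTime]

theorem transport_mul {P : unitInterval → A} (hP : ∀ t, P t * P t = P t) (d : ℝ) (n : ℕ) :
    transport P d n * P 0 = P (stepTime d n) * transport P d n := by
  induction n with
  | zero => simp [transport, stepTime_zero]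
  | succ n ih => rw [transport, mul_assoc, ih, ← mul_assoc, stepTransport_mul (hP _) (hP _),
      mul_assoc]

theorem transport_eq_of_le {P : unitInterval → A} (hP : ∀ t, P t * P t = P t) {d : ℝ} (hd : 0 < d)
    {m n : ℕ} (hm : 1 ≤ m * d) (hmn : m ≤ n) : transport P d n = transport P d m := by
  induction n, hmn using Nat.le_induction with
  | base => rfl
  | succ n hn ih =>
    have h1 : 1 ≤ (n : ℝ) * d := hm.trans (by gcongr)
    have h2 : 1 ≤ ((n + 1 : ℕ) : ℝ) * d := h1.trans (by gcongr; simp)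
    rw [transport, stepTime_eq_one h1, stepTime_eq_one h2, stepTransport_self (hP _), one_mul, ih]

/-- A homotopy of families of idempotents of norm at most one is implemented by a continuous
family of invertible elements. No assumption on the parameter space `X` is needed, because the
step size is the pullback of a continuous function on the metric space of paths. -/
theorem exists_continuous_transport [CompleteSpace A] {P : X → unitInterval → A}
    (hPc : Continuous fun p : X × unitInterval => P p.1 p.2)
    (hP : ∀ x t, P x t * P x t = P x t) (hPn : ∀ x t, ‖P x t‖ ≤ 1) :
    ∃ Y : X → A, Continuous Y ∧ ∀ x, IsUnit (Y x) ∧ Y x * P x 0 = P x 1 * Y x := by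
  obtain ⟨δ', hδ'⟩ := exists_continuous_modulus (E := A) (ε := 1 / 2) (by norm_num)
  let F : C(X, C(unitInterval, A)) := ContinuousMap.curry ⟨_, hPc⟩
  let δ (x : X) : ℝ := δ' (F x)
  have hδc : Continuous δ := δ'.continuous.comp F.continuous
  have hδ0 (x : X) : 0 < δ x := (hδ' (F x)).1
  have hδ (x : X) (s t) (h : dist s t ≤ δ x) : ‖P x s - P x t‖ < 1 / 2 := by
    rw [← dist_eq_norm]; exact (hδ' (F x)).2 s t h
  have hcont (n : ℕ) : Continuous fun x => transport (P x) (δ x) n := by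
    have hPt (n : ℕ) : Continuous fun x => P x (stepTime (δ x) n) :=
      by
      have h1 : Continuous fun x => stepTime (δ x) n :=
        continuous_projIcc.comp (continuous_const.mul hδc)
      exact hPc.comp (continuous_id.prodMk h1)
    induction n with
    | zero => exact continuous_const
    | succ n ih =>
      exact (((hPt (n + 1)).mul (hPt n)).add
        ((continuous_const.sub (hPt (n + 1))).mul (continuous_const.sub (hPt n)))).mul ih
  have hunit (x : X) (n : ℕ) : IsUnit (transport (P x) (δ x) n) := by
    induction n with
    | zero => exact isUnit_one
    | succ n ih =>
      exact (isUnit_stepTransport (hP _ _) (hP _ _) (hPn _ _) (hPn _ _)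
        (hδ x _ _ (dist_stepTime_le (hδ0 x) n))).mul ih
  -- after `N x` steps time `1` is reached, and further steps change nothing
  let N (x : X) : ℕ := ⌈1 / δ x⌉₊
  have hN (x : X) : 1 ≤ N x * δ x := (div_le_iff₀ (hδ0 x)).1 (Nat.le_ceil _)
  refine ⟨fun x => transport (P x) (δ x) (N x), continuous_iff_continuousAt.2 fun x₀ => ?_,
    fun x => ⟨hunit x _, ?_⟩⟩
  · -- near `x₀` the step size exceeds `δ x₀ / 2`, and `m` steps suffice for all `x`
    let m : ℕ := ⌈2 / δ x₀⌉₊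
    refine (hcont m).continuousAt.congr ?_
    filter_upwards [(hδc.tendsto x₀).eventually (lt_mem_nhds (half_lt_self (hδ0 x₀)))] with x hx
    refine transport_eq_of_le (hP x) (hδ0 x) (hN x) (Nat.ceil_mono ?_)
    rw [div_le_div_iff₀ (hδ0 x) (hδ0 x₀)]
    linarith
  · have h := transport_mul (hP x) (δ x) (N x)
    rwa [stepTime_eq_one (hN x)] at h

variable [LocallyCompactSpace X] [T2Space X]
  {H : Type*} [NormedAddCommGroup H] [InnerProductSpace ℂ H] [CompleteSpace H]

theorem Homotopic.fieldEquivalent {α β : C0End X H} (h : Homotopic α β) :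
    FieldEquivalent α β := by
  cases subsingleton_or_nontrivial H with
  | inl hH => exact fieldEquivalent_of_subsingleton α β
  | inr hH =>
    obtain ⟨e, he⟩ := exists_norm_eq H zero_le_one
    obtain ⟨γ⟩ := h.symm
    have hmul (φ : 𝒦 H →⋆ₙₐ[ℂ] 𝒦 H) :
        rep φ (rankOneK e e) * rep φ (rankOneK e e) = rep φ (rankOneK e e) := by
      rw [← map_mul, rankOneK_mul_self he]
    obtain ⟨Y, hY, hY'⟩ := exists_continuous_transport
      (P := fun x t => rep (fiber (γ t) x) (rankOneK e e))
      (𝒦.continuous_coe.comp ((continuous_fiber_family γ.continuous _).comp continuous_swap))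
      (fun x t => hmul _)
      (fun x t => (norm_rep_le _ _).trans (by rw [norm_rankOneK, he, one_mul]))
    simp only [γ.source, γ.target] at hY'
    have hinv (x : X) : Ring.inverse (Y x) * Y x = 1 := Ring.inverse_mul_cancel _ (hY' x).1
    have hinv' (x : X) : Y x * Ring.inverse (Y x) = 1 := Ring.mul_inverse_cancel _ (hY' x).1
    have hYi : Continuous fun x => Ring.inverse (Y x) := by
      refine continuous_iff_continuousAt.2 fun x => ?_
      obtain ⟨y, hy⟩ := (hY' x).1
      have h1 := NormedRing.inverse_continuousAt y
      rw [hy] at h1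
      exact h1.comp hY.continuousAt
    refine fieldEquivalent_of_invertible he
      (L := fun x => Y x * rep (fiber β x) (rankOneK e e))
      (M := fun x => rep (fiber β x) (rankOneK e e) * Ring.inverse (Y x))
      (hY.mul (continuous_rep_fiber β _)) ((continuous_rep_fiber β _).mul hYi)
      (fun x => ?_) (fun x => ?_) (fun x => ?_) (fun x => ?_)
    · rw [mul_assoc, hmul]
    · rw [← mul_assoc, hmul]
    · rw [mul_assoc, ← mul_assoc _ (Y x), hinv, one_mul, hmul]
    · rw [mul_assoc, ← mul_assoc (rep _ _), hmul, ← mul_assoc, (hY' x).2, mul_assoc, hinv',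
        mul_one]

end Transport

/-! ### The shift semigroup on a separable Hilbert space of infinite dimension -/

section Shift

open MeasureTheory

/-- The Hilbert space `L²(ℝ)`. -/
abbrev L2R : Type := Lp ℂ 2 (volume : Measure ℝ)

/-- Translation by `s` on `L²(ℝ)`, `f ↦ f (· - s)`. -/
def translate (s : ℝ) : L2R →ₗᵢ[ℂ] L2R :=
  Lp.compMeasurePreservingₗᵢ ℂ (fun x => x - s) (measurePreserving_sub_right volume s)

theorem translate_ae_eq (s : ℝ) (f : L2R) : translate s f =ᵐ[volume] fun x => f (x - s) :=
  Lp.coeFn_compMeasurePreserving f (measurePreserving_sub_right volume s)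

theorem translate_zero (f : L2R) : translate 0 f = f := by
  refine Lp.ext ((translate_ae_eq 0 f).trans ?_)
  simp

theorem translate_translate_neg (s : ℝ) (f : L2R) : translate s (translate (-s) f) = f := by
  refine Lp.ext ((translate_ae_eq s _).trans ?_)
  have h := (measurePreserving_sub_right volume s).quasiMeasurePreserving.ae_eq_comp
    (translate_ae_eq (-s) f)
  refine h.trans (Eventually.of_forall fun x => ?_)
  simp

theorem continuous_translate (f : L2R) : Continuous fun s => translate s f := by
  let g : C(ℝ, C(ℝ, ℝ)) := ContinuousMap.curry ⟨fun p : ℝ × ℝ => p.2 - p.1, by fun_prop⟩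
  exact Continuous.compMeasurePreservingLp (g := fun s => g s) (f := fun _ => f) continuous_const
    g.continuous (fun s => measurePreserving_sub_right volume s) (by simp)

theorem inner_translate_left (s : ℝ) (f g : L2R) :
    ⟪translate s f, g⟫_ℂ = ⟪f, translate (-s) g⟫_ℂ := by
  conv_lhs => rw [← translate_translate_neg s g]
  exact (translate s).inner_map_map f _

/-- The functions in `L²(ℝ)` that vanish on the right half line. -/
def leftHalf : Submodule ℂ L2R where
  carrier := {f | ∀ᵐ x, 0 ≤ x → f x = 0}
  add_mem' {f g} hf hg := by
    filter_upwards [hf, hg, Lp.coeFn_add f g] with x h1 h2 h3 hx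
    rw [h3, Pi.add_apply, h1 hx, h2 hx, add_zero]
  zero_mem' := by
    filter_upwards [Lp.coeFn_zero ℂ 2 (volume : Measure ℝ)] with x h _
    rw [h]; rfl
  smul_mem' c f hf := by
    filter_upwards [hf, Lp.coeFn_smul c f] with x h1 h2 hx
    rw [h2, Pi.smul_apply, h1 hx, smul_zero]

theorem translate_mem_leftHalf {s : ℝ} (hs : 0 ≤ s) {f : L2R} (hf : f ∈ leftHalf) :
    translate (-s) f ∈ leftHalf := by
  have h := (measurePreserving_sub_right volume (-s)).quasiMeasurePreserving.ae
    (show ∀ᵐ x, 0 ≤ x → f x = 0 from hf)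
  change ∀ᵐ x, 0 ≤ x → translate (-s) f x = 0
  filter_upwards [h, translate_ae_eq (-s) f] with x h1 h2 hx
  rw [h2]
  exact h1 (by linarith)

/-- The functions in `L²(ℝ)` supported on the right half line, as an orthogonal complement. -/
abbrev rightHalf : Submodule ℂ L2R := leftHalfᗮ

theorem translate_mem_rightHalf {s : ℝ} (hs : 0 ≤ s) {f : L2R} (hf : f ∈ rightHalf) :
    translate s f ∈ rightHalf := by
  rw [Submodule.mem_orthogonal'] at hf ⊢
  intro g hg
  rw [inner_translate_left]
  exact hf _ (translate_mem_leftHalf hs hg)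

theorem rightHalf_ne_bot : rightHalf ≠ ⊥ := by
  intro h
  let g : L2R := indicatorConstLp 2 (measurableSet_Icc (a := (0 : ℝ)) (b := 1)) (by simp) 1
  have hg : g ∈ rightHalf := by
    rw [Submodule.mem_orthogonal']
    intro f hf
    rw [L2.inner_indicatorConstLp_one]
    refine integral_eq_zero_of_ae ?_
    refine (ae_restrict_iff' measurableSet_Icc).2 ?_
    filter_upwards [show ∀ᵐ x, 0 ≤ x → f x = 0 from hf] with x hx hx'
    exact hx hx'.1
  rw [h, Submodule.mem_bot] at hg
  have h1 : ‖g‖ = 0 := by rw [hg, norm_zero]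
  rw [norm_indicatorConstLp (by simp) (by simp)] at h1
  simp at h1

/-- A compactly supported function is eventually translated into the left half line; such
functions are dense in `L²(ℝ)`. -/
theorem exists_translate_mem_leftHalf (f : L2R) {ε : ℝ} (hε : 0 < ε) :
    ∃ g : L2R, ‖f - g‖ ≤ ε ∧ ∀ᶠ s : ℝ in atTop, translate (-s) g ∈ leftHalf := by
  obtain ⟨g, hgs, hfg, -, hgm⟩ := (Lp.memLp f).exists_hasCompactSupport_eLpNorm_sub_le
    (by simp) (ENNReal.ofReal_pos.2 hε).ne'
  refine ⟨hgm.toLp g, ?_, ?_⟩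
  · rw [← dist_eq_norm, dist_edist]
    conv_lhs => rw [← Lp.toLp_coeFn f (Lp.memLp f)]
    rw [Lp.edist_toLp_toLp]
    exact ENNReal.toReal_le_of_le_ofReal hε.le hfg
  · obtain ⟨R, hR⟩ := hgs.isCompact.isBounded.subset_closedBall 0
    filter_upwards [eventually_gt_atTop R] with s hs
    have h := (measurePreserving_sub_right volume (-s)).quasiMeasurePreserving.ae_eq_comp
      (hgm.coeFn_toLp)
    change ∀ᵐ x, 0 ≤ x → translate (-s) (hgm.toLp g) x = 0
    filter_upwards [h, translate_ae_eq (-s) (hgm.toLp g)] with x h1 h2 hx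
    rw [h2]
    refine h1.trans (image_eq_zero_of_notMem_tsupport (f := g) (x := x - -s) fun hx' => ?_)
    have h3 := hR hx'
    rw [Metric.mem_closedBall, dist_zero_right, Real.norm_eq_abs] at h3
    linarith [le_abs_self (x - -s)]

variable {H : Type*} [NormedAddCommGroup H] [InnerProductSpace ℂ H] [CompleteSpace H]

/-- The one-parameter semigroup `T` of unilateral shifts, on a Hilbert space identified with
`L²[0, ∞)` by `J`. Only times `s ≥ 0` are relevant, but the compression of the translation makes
sense for all `s`. -/
theorem exists_shift_of_range (J : H →ₗᵢ[ℂ] L2R) (hJ : ∀ f, f ∈ rightHalf ↔ ∃ ξ, J ξ = f) :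
    ∃ T : ℝ → H →L[ℂ] H, T 0 = 1 ∧ (∀ s, 0 ≤ s → star (T s) * T s = 1) ∧
      (∀ ξ, Continuous fun s => T s ξ) ∧ (∀ ξ, Continuous fun s => star (T s) ξ) ∧
      ∀ ξ, Tendsto (fun s => star (T s) ξ) atTop (𝓝 0) := by
  let j : H →L[ℂ] L2R := J.toContinuousLinearMap
  let T (s : ℝ) : H →L[ℂ] H := j.adjoint ∘L (translate s).toContinuousLinearMap ∘L j
  have hT (s : ℝ) (ξ : H) : T s ξ = j.adjoint (translate s (J ξ)) := rfl
  have hjj (ξ : H) : j.adjoint (J ξ) = ξ := by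
    refine ext_inner_right ℂ fun η => ?_
    rw [ContinuousLinearMap.adjoint_inner_left]
    exact J.inner_map_map ξ η
  have hTs (s : ℝ) : star (T s) = T (-s) := by
    rw [ContinuousLinearMap.star_eq_adjoint, eq_comm, ContinuousLinearMap.eq_adjoint_iff]
    intro ξ η
    rw [hT, hT, ContinuousLinearMap.adjoint_inner_left, ContinuousLinearMap.adjoint_inner_right]
    change ⟪translate (-s) (J ξ), J η⟫_ℂ = ⟪J ξ, translate s (J η)⟫_ℂ
    rw [inner_translate_left, neg_neg]
  have hTc (ξ : H) : Continuous fun s => T s ξ :=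
    j.adjoint.continuous.comp (continuous_translate (J ξ))
  have hker {f : L2R} (hf : f ∈ leftHalf) : j.adjoint f = 0 := by
    refine ext_inner_right ℂ fun η => ?_
    rw [ContinuousLinearMap.adjoint_inner_left, inner_zero_left]
    exact (Submodule.mem_orthogonal _ _).1 ((hJ _).2 ⟨η, rfl⟩) f hf
  have hjn (f : L2R) : ‖j.adjoint f‖ ≤ ‖f‖ := by
    have h := j.adjoint.le_of_opNorm_le
      ((LinearIsometryEquiv.norm_map _ j).trans_le J.norm_toContinuousLinearMap_le) f
    rwa [one_mul] at h
  refine ⟨T, ?_, fun s hs => ?_, hTc, fun ξ => ?_, fun ξ => ?_⟩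
  · ext ξ
    rw [hT, translate_zero, hjj]
    rfl
  · refine (ContinuousLinearMap.norm_map_iff_adjoint_comp_self _).1 fun ξ => ?_
    obtain ⟨η, hη⟩ := (hJ _).1 (translate_mem_rightHalf hs ((hJ _).2 ⟨ξ, rfl⟩))
    rw [hT, ← hη, hjj, ← J.norm_map η, hη, LinearIsometry.norm_map, LinearIsometry.norm_map]
  · simp only [hTs]
    exact (hTc ξ).comp continuous_neg
  · rw [Metric.tendsto_nhds]
    intro ε hε
    obtain ⟨g, hg, hgl⟩ := exists_translate_mem_leftHalf (J ξ) (half_pos hε)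
    filter_upwards [hgl] with s hs
    have e : star (T s) ξ = j.adjoint (translate (-s) (J ξ - g)) := by
      rw [hTs, hT, map_sub, map_sub, hker hs, sub_zero]
    rw [e, dist_zero_right]
    exact (((hjn _).trans_eq (LinearIsometry.norm_map _ _)).trans hg).trans_lt (half_lt_self hε)

theorem not_finiteDimensional_rightHalf : ¬ FiniteDimensional ℂ rightHalf := by
  intro hfin
  obtain ⟨T, -, hT, -, -, hT0⟩ := exists_shift_of_range rightHalf.subtypeₗᵢ fun f =>
    ⟨fun hf => ⟨⟨f, hf⟩, rfl⟩, by rintro ⟨ξ, rfl⟩; exact ξ.2⟩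
  obtain ⟨f, hf, hf0⟩ := Submodule.exists_mem_ne_zero_of_ne_bot rightHalf_ne_bot
  -- in finite dimensions, the isometries `T s` are unitary, so that `(T s)* f` cannot tend to `0`
  have h1 (s : ℝ) (hs : 0 ≤ s) : ‖star (T s) ⟨f, hf⟩‖ = ‖(⟨f, hf⟩ : rightHalf)‖ := by
    have h2 : T s * star (T s) = 1 := by
      have h3 : ((T s : rightHalf →L[ℂ] rightHalf) : rightHalf →ₗ[ℂ] rightHalf)
          * ((star (T s) : rightHalf →L[ℂ] rightHalf) : rightHalf →ₗ[ℂ] rightHalf) = 1 :=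
        mul_eq_one_comm.1 (by ext1 ξ; exact congr($(hT s hs) ξ))
      ext1 ξ
      exact congr($h3 ξ)
    exact norm_apply_of_star_mul_self (by rw [star_star, h2]) _
  have h4 := (hT0 ⟨f, hf⟩).norm
  rw [norm_zero] at h4
  have h5 := tendsto_nhds_unique (tendsto_const_nhds.congr' (by
    filter_upwards [eventually_ge_atTop 0] with s hs using (h1 s hs).symm)) h4
  exact hf0 (congr(Subtype.val $(norm_eq_zero.1 h5)))

omit [CompleteSpace H] in
theorem HilbertBasis.countable_of_separable {ι : Type*} [TopologicalSpace.SeparableSpace H]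
    (b : HilbertBasis ι ℂ H) : Countable ι := by
  refine Pairwise.countable_of_isOpen_disjoint (s := fun i => Metric.ball (b i) (1 / 2))
    (fun i k hik => ?_) (fun _ => Metric.isOpen_ball)
    (fun i => ⟨b i, Metric.mem_ball_self (by norm_num)⟩)
  refine Metric.ball_disjoint_ball ?_
  have h1 : ‖b i - b k‖ ^ 2 = 2 := by
    rw [@norm_sub_sq ℂ, b.orthonormal.1, b.orthonormal.1, b.orthonormal.2 hik]
    norm_num
  rw [dist_eq_norm]
  nlinarith [norm_nonneg (b i - b k)]

omit [CompleteSpace H] in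
theorem HilbertBasis.infinite_of_not_finiteDimensional {ι : Type*} (hH : ¬ FiniteDimensional ℂ H)
    (b : HilbertBasis ι ℂ H) : Infinite ι := by
  by_contra h
  rw [not_infinite_iff_finite] at h
  have := Fintype.ofFinite ι
  exact hH (Module.Finite.of_basis b.toOrthonormalBasis.toBasis)

/-- Separable Hilbert spaces of infinite dimension are isomorphic. -/
theorem nonempty_linearIsometryEquiv {E : Type*} [NormedAddCommGroup E] [InnerProductSpace ℂ E]
    [CompleteSpace E] [TopologicalSpace.SeparableSpace E] [TopologicalSpace.SeparableSpace H]
    (hE : ¬ FiniteDimensional ℂ E) (hH : ¬ FiniteDimensional ℂ H) : Nonempty (H ≃ₗᵢ[ℂ] E) := by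
  obtain ⟨I, b, -⟩ := exists_hilbertBasis ℂ H
  obtain ⟨K, c, -⟩ := exists_hilbertBasis ℂ E
  have := HilbertBasis.countable_of_separable b
  have := HilbertBasis.countable_of_separable c
  have := HilbertBasis.infinite_of_not_finiteDimensional hH b
  have := HilbertBasis.infinite_of_not_finiteDimensional hE c
  obtain ⟨f⟩ := nonempty_equiv_of_countable (α := I) (β := K)
  let c' : HilbertBasis I ℂ E := HilbertBasis.mk (c.orthonormal.comp f f.injective) (by
    rw [f.surjective.range_comp]
    exact c.dense_span.ge)
  exact ⟨b.repr.trans c'.repr.symm⟩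

/-- The semigroup of unilateral shifts on a separable Hilbert space of infinite dimension. -/
theorem exists_shift [TopologicalSpace.SeparableSpace H] (hH : ¬ FiniteDimensional ℂ H) :
    ∃ T : ℝ → H →L[ℂ] H, T 0 = 1 ∧ (∀ s, 0 ≤ s → star (T s) * T s = 1) ∧
      (∀ ξ, Continuous fun s => T s ξ) ∧ (∀ ξ, Continuous fun s => star (T s) ξ) ∧
      ∀ ξ, Tendsto (fun s => star (T s) ξ) atTop (𝓝 0) := by
  have : TopologicalSpace.SeparableSpace rightHalf := by
    have : Fact ((2 : ENNReal) ≠ ⊤) := ⟨by simp⟩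
    have : SecondCountableTopology L2R := inferInstance
    infer_instance
  obtain ⟨W⟩ := nonempty_linearIsometryEquiv not_finiteDimensional_rightHalf hH
  refine exists_shift_of_range (rightHalf.subtypeₗᵢ.comp W.toLinearIsometry) fun f =>
    ⟨fun hf => ⟨W.symm ⟨f, hf⟩, ?_⟩, ?_⟩
  · simp
  · rintro ⟨ξ, rfl⟩
    exact (W ξ).2

end Shift

/-! ### Contraction of the strongly continuous families of unitaries -/

section Homotopy

variable {H : Type*} [NormedAddCommGroup H] [InnerProductSpace ℂ H] [CompleteSpace H]

/-- The isometries `V r`, `r ∈ [0, 1]`, obtained by running the shift semigroup backwards from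
time `∞`, at `r = 0`, to time `0`, at `r = 1`. Here `V 0 = 0` is the limit only of the adjoints. -/
theorem exists_shrinking_isometries [TopologicalSpace.SeparableSpace H]
    (hH : ¬ FiniteDimensional ℂ H) :
    ∃ V : unitInterval → H →L[ℂ] H, V 0 = 0 ∧ V 1 = 1 ∧ (∀ r ≠ 0, star (V r) * V r = 1) ∧
      (∀ ξ, Continuous fun r => star (V r) ξ) ∧
      ∀ ξ, ∀ r ≠ 0, ContinuousAt (fun r => V r ξ) r := by
  obtain ⟨T, hT0, hT1, hTc, hTc', hT⟩ := exists_shift hH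
  let f (r : unitInterval) : ℝ := (r : ℝ)⁻¹ - 1
  have hfc (r : unitInterval) (hr : r ≠ 0) : ContinuousAt f r :=
    (continuous_subtype_val.continuousAt.inv₀ (by simpa using hr)).sub continuousAt_const
  have hev (r : unitInterval) (hr : r ≠ 0) : ∀ᶠ r' in 𝓝 r, r' ≠ 0 :=
    isOpen_ne.mem_nhds hr
  refine ⟨fun r => if r = 0 then 0 else T (f r), by simp, by simp [f, hT0], fun r hr => ?_,
    fun ξ => ?_, fun ξ r hr => ?_⟩
  · simp only [hr, if_false]
    refine hT1 _ (sub_nonneg.2 (one_le_inv_iff₀.2 ⟨?_, r.2.2⟩))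
    exact lt_of_le_of_ne r.2.1 fun h => hr (Subtype.ext h.symm)
  · refine continuous_iff_continuousAt.2 fun r => ?_
    by_cases hr : r = 0
    · subst hr
      rw [← continuousWithinAt_compl_self]
      have h1 : Tendsto f (𝓝[≠] 0) atTop := by
        refine tendsto_atTop_add_const_right _ _ (tendsto_inv_nhdsGT_zero.comp ?_)
        refine tendsto_nhdsWithin_iff.2 ⟨?_, ?_⟩
        · exact (continuous_subtype_val.tendsto (0 : unitInterval)).mono_left nhdsWithin_le_nhds
        · filter_upwards [self_mem_nhdsWithin] with r hr
          exact lt_of_le_of_ne r.2.1 fun h => hr (Subtype.ext h.symm)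
      have h2 := (hT ξ).comp h1
      refine Tendsto.congr' ?_ (by simpa using h2)
      filter_upwards [self_mem_nhdsWithin] with r hr
      have hr' : r ≠ 0 := hr
      simp [hr']
    · refine ((hTc' ξ).continuousAt.comp (hfc r hr)).congr ?_
      filter_upwards [hev r hr] with r' hr'
      simp [hr']
  · refine ((hTc ξ).continuousAt.comp (hfc r hr)).congr ?_
    filter_upwards [hev r hr] with r' hr'
    simp [hr']

variable {X : Type*} [TopologicalSpace X]

/-- Compressing a strongly continuous family of unitaries `u` to `V u V* + (1 - V V*)`, with
shrinking isometries `V`, contracts it to the constant family `1`. -/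
theorem isUnitaryField_contraction {V : unitInterval → H →L[ℂ] H} (hV0 : V 0 = 0)
    (hV : ∀ r ≠ 0, star (V r) * V r = 1) (hVs : ∀ ξ, Continuous fun r => star (V r) ξ)
    (hVc : ∀ ξ, ∀ r ≠ 0, ContinuousAt (fun r => V r ξ) r) {u : X → H →L[ℂ] H}
    (hu : IsUnitaryField u) :
    IsUnitaryField fun p : unitInterval × X => 1 + V p.1 * (u p.2 - 1) * star (V p.1) := by
  have hVn (r : unitInterval) (ξ : H) : ‖V r ξ‖ ≤ ‖ξ‖ := by
    by_cases hr : r = 0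
    · simp [hr, hV0]
    · exact (norm_apply_of_star_mul_self (hV r hr) ξ).le
  have key (r : unitInterval) {a b : H →L[ℂ] H} (hab : a * b = 1) :
      (1 + V r * (a - 1) * star (V r)) * (1 + V r * (b - 1) * star (V r)) = 1 := by
    by_cases hr : r = 0
    · simp [hr, hV0]
    · have h1 : V r * (a - 1) * star (V r) * (V r * (b - 1) * star (V r))
          = V r * ((a - 1) * (b - 1)) * star (V r) := by
        calc _ = V r * (a - 1) * (star (V r) * V r) * (b - 1) * star (V r) := by
              simp only [mul_assoc]
          _ = _ := by rw [hV r hr, mul_one]; simp only [mul_assoc]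
      have h2 : (a - 1) * (b - 1) = -(a - 1) - (b - 1) := by
        simp only [mul_sub, sub_mul, hab, mul_one, one_mul]
        abel
      rw [mul_add, add_mul, add_mul, h1, h2]
      simp only [mul_sub, sub_mul, mul_neg, neg_mul, mul_one, one_mul]
      abel
  refine ⟨fun p => ?_, fun ξ => ?_⟩
  · have hs : star (1 + V p.1 * (u p.2 - 1) * star (V p.1))
        = 1 + V p.1 * (star (u p.2) - 1) * star (V p.1) := by
      simp [mul_assoc]
    exact ⟨by rw [hs]; exact key _ (hu.star_mul_self _),
      by rw [hs]; exact key _ (hu.mul_star_self _)⟩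
  · let η (p : unitInterval × X) : H := u p.2 (star (V p.1) ξ) - star (V p.1) ξ
    have hη : Continuous η :=
      (hu.continuous_apply₂ continuous_snd ((hVs ξ).comp continuous_fst)).sub
        ((hVs ξ).comp continuous_fst)
    change Continuous fun p : unitInterval × X => ξ + V p.1 (η p)
    refine continuous_const.add (continuous_iff_continuousAt.2 ?_)
    rintro ⟨r, x⟩
    refine tendsto_iff_norm_sub_tendsto_zero.2 ?_
    have h1 := tendsto_iff_norm_sub_tendsto_zero.1 (hη.tendsto (r, x))
    have h2 : Tendsto (fun p : unitInterval × X => ‖V p.1 (η (r, x)) - V r (η (r, x))‖)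
        (𝓝 (r, x)) (𝓝 0) := by
      by_cases hr : r = 0
      · have h3 : η (r, x) = 0 := by simp [η, hr, hV0]
        simp [h3]
      · exact tendsto_iff_norm_sub_tendsto_zero.1
          ((hVc (η (r, x)) r hr).tendsto.comp (continuous_fst.tendsto (r, x)))
    have h3 := h1.add h2
    rw [add_zero] at h3
    refine squeeze_zero (fun _ => norm_nonneg _) (fun p => ?_) h3
    have e : V p.1 (η p) - V r (η (r, x))
        = V p.1 (η p - η (r, x)) + (V p.1 (η (r, x)) - V r (η (r, x))) := by
      rw [(V p.1).map_sub (η p) (η (r, x))]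
      abel
    rw [e]
    exact (norm_add_le _ _).trans (add_le_add (hVn _ _) le_rfl)

protected theorem IsUnitaryField.comp {Y : Type*} [TopologicalSpace Y] {u : X → H →L[ℂ] H}
    (hu : IsUnitaryField u) {g : Y → X} (hg : Continuous g) : IsUnitaryField fun y => u (g y) :=
  ⟨fun y => hu.mem_unitary (g y), fun ξ => (hu.continuous_apply ξ).comp hg⟩

/-- The `C₀(X)`-endomorphism `Ad u ∘ β` for a strongly continuous family of unitaries `u`. -/
def IsUnitaryField.conj {u : X → H →L[ℂ] H} (hu : IsUnitaryField u) (β : C0End X H) :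
    C0End X H where
  toHom :=
    { toFun := fun f => hu.star.mulRight (hu.mulLeft (β f))
      map_smul' := fun c f => DFunLike.ext _ _ fun x => Subtype.ext (by
        change u x * (β.toHom (c • f) x).1 * star (u x)
          = c • (u x * (β f x).1 * star (u x))
        rw [map_smul, ZeroAtInftyContinuousMap.smul_apply, 𝒦.coe_smul, mul_smul_comm,
          smul_mul_assoc])
      map_zero' := DFunLike.ext _ _ fun x => Subtype.ext (by
        change u x * (β.toHom 0 x).1 * star (u x) = 0
        rw [map_zero, ZeroAtInftyContinuousMap.zero_apply, 𝒦.coe_zero, mul_zero, zero_mul])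
      map_add' := fun f g => DFunLike.ext _ _ fun x => Subtype.ext (by
        change u x * (β.toHom (f + g) x).1 * star (u x)
          = u x * (β f x).1 * star (u x) + u x * (β g x).1 * star (u x)
        rw [map_add, ZeroAtInftyContinuousMap.add_apply, 𝒦.coe_add, mul_add, add_mul])
      map_mul' := fun f g => DFunLike.ext _ _ fun x => Subtype.ext (by
        change u x * (β.toHom (f * g) x).1 * star (u x)
          = u x * (β f x).1 * star (u x) * (u x * (β g x).1 * star (u x))
        rw [map_mul, ZeroAtInftyContinuousMap.mul_apply, 𝒦.coe_mul]
        calc _ = u x * (β f x).1 * 1 * (β g x).1 * star (u x) := by simp only [mul_assoc, one_mul]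
          _ = _ := by rw [← hu.star_mul_self x]; simp only [mul_assoc])
      map_star' := fun f => DFunLike.ext _ _ fun x => Subtype.ext (by
        change u x * (β.toHom (star f) x).1 * star (u x)
          = star (u x * (β f x).1 * star (u x))
        rw [map_star, ZeroAtInftyContinuousMap.star_apply, 𝒦.coe_star, star_mul, star_mul,
          star_star]
        simp only [mul_assoc]) }
  map_C0smul g f := DFunLike.ext _ _ fun x => Subtype.ext (by
    change u x * (β.toHom (C0smul g f) x).1 * star (u x)
      = g x • (u x * (β f x).1 * star (u x))
    rw [β.map_C0smul]
    change u x * (g x • (β f x).1) * star (u x) = _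
    rw [mul_smul_comm, smul_mul_assoc])
  map_approximateUnit l hl := by
    have h := β.map_approximateUnit l hl
    have := hl.neBot
    refine ⟨fun m => ?_, fun m => ?_⟩
    · rw [tendsto_map'_iff]
      have h1 := tendsto_map'_iff.1 (h.tendsto_mul_left (hu.multiplier.snd m))
      have h2 := (hu.star.multiplier.snd.continuous.tendsto _).comp h1
      have e : hu.star.multiplier.snd (hu.multiplier.snd m) = m :=
        DFunLike.ext _ _ fun x => Subtype.ext (by
          change (m x).1 * u x * star (u x) = (m x).1
          rw [mul_assoc, hu.mul_star_self, mul_one])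
      rw [e] at h2
      refine h2.congr fun f => DFunLike.ext _ _ fun x => Subtype.ext ?_
      change (m x).1 * u x * (β f x).1 * star (u x) = (m x).1 * (u x * (β f x).1 * star (u x))
      simp only [mul_assoc]
    · rw [tendsto_map'_iff]
      have h1 := tendsto_map'_iff.1 (h.tendsto_mul_right (hu.star.multiplier.fst m))
      have h2 := (hu.multiplier.fst.continuous.tendsto _).comp h1
      have e : hu.multiplier.fst (hu.star.multiplier.fst m) = m :=
        DFunLike.ext _ _ fun x => Subtype.ext (by
          change u x * (star (u x) * (m x).1) = (m x).1
          rw [← mul_assoc, hu.mul_star_self, one_mul])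
      rw [e] at h2
      refine h2.congr fun f => DFunLike.ext _ _ fun x => Subtype.ext ?_
      change u x * ((β f x).1 * (star (u x) * (m x).1)) = u x * (β f x).1 * star (u x) * (m x).1
      simp only [mul_assoc]

theorem IsUnitaryField.conj_apply {u : X → H →L[ℂ] H} (hu : IsUnitaryField u) (β : C0End X H)
    (f : C0K X H) (x : X) : (hu.conj β f x).1 = u x * (β f x).1 * star (u x) := rfl

theorem IsUnitaryField.norm_conj_apply_le {u : X → H →L[ℂ] H} (hu : IsUnitaryField u)
    (β : C0End X H) (f : C0K X H) (x : X) : ‖hu.conj β f x‖ ≤ ‖β f x‖ := by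
  change ‖u x * (β f x).1 * star (u x)‖ ≤ ‖(β f x).1‖
  refine (norm_mul_le _ _).trans ?_
  refine (mul_le_of_le_one_right (norm_nonneg _) (hu.star.norm_le x)).trans ?_
  exact (norm_mul_le _ _).trans (mul_le_of_le_one_left (norm_nonneg _) (hu.norm_le x))

theorem C0End.ext {α β : C0End X H} (h : ∀ f x, (α f x).1 = (β f x).1) : α = β := by
  cases α
  cases β
  congr 1
  exact DFunLike.ext _ _ fun f => DFunLike.ext _ _ fun x => Subtype.ext (h f x)

/-- A jointly continuous family of functions that is dominated by a function vanishing at infinity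
is a continuous family in `C₀(X) ⊗ K`. -/
theorem continuous_C0K_of_dominated {Y : Type*} [TopologicalSpace Y] {g : Y → C0K X H}
    (k : C0K X H) (hg : Continuous fun p : Y × X => g p.1 p.2) (hk : ∀ y x, ‖g y x‖ ≤ ‖k x‖) :
    Continuous g := by
  refine continuous_iff_continuousAt.2 fun y₀ => Metric.tendsto_nhds.2 fun ε hε => ?_
  have hk0 : ∀ᶠ x in cocompact X, ‖k x‖ < ε / 4 := by
    have h := (zero_at_infty k).norm
    rw [norm_zero] at h
    exact h.eventually (gt_mem_nhds (by positivity))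
  obtain ⟨K, hK, hKk⟩ := mem_cocompact.1 hk0
  have hev : ∀ᶠ y in 𝓝 y₀, ∀ x ∈ K, ‖g y x - g y₀ x‖ < ε / 2 := by
    refine hK.eventually_forall_of_forall_eventually fun x _ => ?_
    have h : Continuous fun p : Y × X => ‖g p.1 p.2 - g y₀ p.2‖ :=
      (hg.sub (hg.comp (continuous_const.prodMk continuous_snd))).norm
    refine (h.tendsto (y₀, x)).eventually (gt_mem_nhds ?_)
    simpa using hε
  filter_upwards [hev] with y hy
  rw [dist_eq_norm]
  refine (C0K.norm_le_of_forall (half_pos hε).le fun x => ?_).trans_lt (half_lt_self hε)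
  by_cases hx : x ∈ K
  · exact (hy x hx).le
  · have h1 : ‖k x‖ < ε / 4 := hKk hx
    have h2 : ‖g y x - g y₀ x‖ ≤ ‖g y x‖ + ‖g y₀ x‖ := norm_sub_le _ _
    change ‖g y x - g y₀ x‖ ≤ ε / 2
    linarith [hk y x, hk y₀ x]

variable [LocallyCompactSpace X] [T2Space X]

theorem FieldEquivalent.homotopic [TopologicalSpace.SeparableSpace H]
    (hH : ¬ FiniteDimensional ℂ H) {α β : C0End X H} (h : FieldEquivalent α β) :
    Homotopic α β := by
  obtain ⟨u, hu, hint⟩ := h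
  obtain ⟨V, hV0, hV1, hV, hVs, hVc⟩ := exists_shrinking_isometries hH
  have hU := isUnitaryField_contraction hV0 hV hVs hVc hu
  have hUt (t : unitInterval) :=
    hU.comp (continuous_const.prodMk continuous_id : Continuous fun x : X => (t, x))
  refine Joined.symm ⟨⟨⟨fun t => (hUt t).conj β, ?_⟩, ?_, ?_⟩⟩
  · refine continuous_induced_rng.2 (continuous_pi fun f => ?_)
    refine continuous_C0K_of_dominated (β f) (continuous_induced_rng.2 ?_) fun t x => ?_
    · have h1 := hU.continuous_mul (k := fun p => β f p.2)
        ((map_continuous (β f)).comp continuous_snd)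
      exact hU.star.continuous_mul_right (k := fun p => (hUt p.1).mulLeft (β f) p.2)
        (continuous_induced_rng.2 h1)
    · exact (hUt t).norm_conj_apply_le β f x
  · refine C0End.ext fun f x => ?_
    rw [IsUnitaryField.conj_apply]
    simp [hV0]
  · refine C0End.ext fun f x => ?_
    rw [IsUnitaryField.conj_apply]
    have h1 : 1 + V 1 * (u x - 1) * star (V 1) = u x := by simp [hV1]
    simp only [h1]
    rw [apply_eq_fiber, apply_eq_fiber]
    change u x * rep (fiber β x) (f x) * star (u x) = rep (fiber α x) (f x)
    rw [hint, mul_assoc, hu.mul_star_self, mul_one]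

end Homotopy

end CXEnd

end

theorem mainTheorem2 {X : Type*} [TopologicalSpace X] [LocallyCompactSpace X] [T2Space X]
    {H : Type*} [NormedAddCommGroup H] [InnerProductSpace ℂ H] [CompleteSpace H]
    [TopologicalSpace.SeparableSpace H] (α β : CXEnd.C0End X H) :
    (Nonempty (CXEnd.VectIso α β) ↔ CXEnd.InnerEquivalent α β) ∧
    ((∃ e : CXEnd.VectIso α β, e.IsHermitian) ↔ CXEnd.InnerEquivalent α β) ∧
    (¬ FiniteDimensional ℂ H → (CXEnd.Homotopic α β ↔ CXEnd.InnerEquivalent α β)) := by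
  refine ⟨⟨?_, ?_⟩, ⟨?_, ?_⟩, fun hH => ⟨?_, ?_⟩⟩
  · rintro ⟨i⟩
    exact i.fieldEquivalent.innerEquivalent
  · intro h
    obtain ⟨i, -⟩ := h.fieldEquivalent.exists_hermitian_vectIso
    exact ⟨i⟩
  · rintro ⟨i, -⟩
    exact i.fieldEquivalent.innerEquivalent
  · intro h
    exact h.fieldEquivalent.exists_hermitian_vectIso
  · intro h
    exact (CXEnd.Homotopic.fieldEquivalent h).innerEquivalent
  · intro h
    exact h.fieldEquivalent.homotopic hH
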